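/- Let $d\ge 2$ be a fixed integer. An instance $(G,w,t)$ of Exact-Edge-Weight $d$-Uniform Hyperclique consists of a $d$-uniform hypergraph $G$ on finitely many vertices, a weight function $w\colon E(G)\to\mathbb{N}_0$, and a target $t\in\mathbb{N}_0$. It is a YES-instance if there is a set $S\subseteq V(G)$ such that every $d$-element subset of $S$ is a hyperedge of $G$ and the total weight of the hyperedges contained in $S$ is exactly $t$; otherwise it is a NO-instance. (For $d=2$ this is Exact-Edge-Weight Clique.) There is a randomized algorithm, with worst-case running time polynomial in the bitsize of its input, that, given an instance $(G,w,t)$ with $n\ge 1$ vertices, always outputs an instance $(G',w',t')$ of the same problem, with $t'\ge 1$, of bitsize $\mathcal{O}(n^{d+1})$, in which each number (each weight $w'(e)$ and the target $t'$) is at most $2^{\mathcal{O}(n)}$, such that: 1. if $(G,w,t)$ is a YES-instance, then $(G',w',t')$ is always a YES-instance; 2. if $(G,w,t)$ is a NO-instance, then $(G',w',t')$ is a NO-instance with probability at least $1-2^{-n}$. The constants hidden in the $\mathcal{O}$-notation and the polynomial bounding the running time depend only on $d$. Instances are encoded by the number of vertices, the target, and the adjacency array of $G$ with its weights, all numbers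 being written in binary. -/

import Mathlib

open MeasureTheory

/-! ### Exact-Edge-Weight `d`-Uniform Hyperclique -/

/-- An instance `(G, w, t)`: a `d`-uniform hypergraph with vertex set `Fin n`, a weight in `ℕ` for
each hyperedge, and a target value. For `d = 2` the hypergraph is a simple graph. -/
structure EEWInstance (d : ℕ) where
  n : ℕ
  edges : Finset (Finset (Fin n))
  uniform : ∀ e ∈ edges, e.card = d
  weight : {e // e ∈ edges} → ℕ
  target : ℕ

namespace EEWInstance

variable {d : ℕ}

/-- `S` is a hyperclique: each of its subsets of size `d` is a hyperedge. -/
def IsHyperclique (I : EEWInstance d) (S : Finset (Fin I.n)) : Prop :=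
  ∀ e : Finset (Fin I.n), e ⊆ S → e.card = d → e ∈ I.edges

/-- The total weight of the hyperedges contained in `S`. -/
def weightOf (I : EEWInstance d) (S : Finset (Fin I.n)) : ℕ :=
  ∑ e : {e // e ∈ I.edges} with e.1 ⊆ S, I.weight e

/-- YES-instance: some hyperclique has total weight exactly the target. -/
def IsYes (I : EEWInstance d) : Prop :=
  ∃ S : Finset (Fin I.n), I.IsHyperclique S ∧ I.weightOf S = I.target

/-- The entry of the adjacency array at a tuple of vertices: `0` if the vertices of the tuple do
not form a hyperedge (in particular if two of them coincide), and `w(e) + 1` if they form the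
hyperedge `e`. -/
def entry (I : EEWInstance d) (v : Fin d → Fin I.n) : ℕ :=
  if h : Finset.univ.image v ∈ I.edges then I.weight ⟨Finset.univ.image v, h⟩ + 1 else 0

/-- The encoding of an instance as a sequence of natural numbers: the number `n` of vertices, the
target, and the adjacency array of size `n ^ d`, whose position `k` belongs to the tuple
`(k / n ^ i % n)_{i < d}` of the base-`n` digits of `k`. -/
def encode (I : EEWInstance d) : List ℕ :=
  I.n :: I.target :: List.ofFn fun k : Fin (I.n ^ d) => I.entry (finFunctionFinEquiv.symm k)

end EEWInstance

/-- The number of bits of a sequence of natural numbers: each is written in binary in a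
self-delimiting way, with a `1` before each binary digit and a `0` at the end of the number. -/
def bitSize (l : List ℕ) : ℕ := (l.map fun x => 2 * Nat.size x + 1).sum

/-! ### Randomized algorithms: a random access machine with logarithmic cost

Memory cells hold natural numbers and are addressed by natural numbers, with indirect addressing.
There is an input tape and an output tape of natural numbers, and a supply of fair coins. Every
operation is charged the bit lengths of all the numbers and addresses it handles. -/

namespace RAM

/-- The arithmetic operations; subtraction is truncated. -/
inductive Op
  | add | sub | mul | div | mod

def Op.eval : Op → ℕ → ℕ → ℕ
  | .add, x, y => x + y
  | .sub, x, y => x - y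
  | .mul, x, y => x * y
  | .div, x, y => x / y
  | .mod, x, y => x % y

/-- Expressions: constants, the contents of the cell at a computed address, and arithmetic. -/
inductive Expr
  | lit (c : ℕ)
  | cell (a : Expr)
  | op (o : Op) (a b : Expr)

def Expr.eval (M : ℕ → ℕ) : Expr → ℕ
  | .lit c => c
  | .cell a => M (a.eval M)
  | .op o a b => o.eval (a.eval M) (b.eval M)

/-- The logarithmic cost of evaluating an expression: one plus the bit length of the value, for
each of its subexpressions. -/
def Expr.cost (M : ℕ → ℕ) : Expr → ℕ
  | .lit c => 1 + Nat.size c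
  | .cell a => a.cost M + 1 + Nat.size (M (a.eval M))
  | .op o a b => a.cost M + b.cost M + 1 + Nat.size (o.eval (a.eval M) (b.eval M))

/-- Programs. `assign a e` stores the value of `e` in the cell with address `a`, `read a` stores
the next number of the input tape there, `toss a` stores the outcome of a fresh coin there, and
`write e` appends a number to the output tape. A condition is true if its value is not `0`. -/
inductive Prog
  | assign (a e : Expr)
  | read (a : Expr)
  | toss (a : Expr)
  | write (e : Expr)
  | seq (p q : Prog)
  | ite (e : Expr) (p q : Prog)
  | loop (e : Expr) (p : Prog)

structure State where
  mem : ℕ → ℕ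
  input : List ℕ
  output : List ℕ
  tossed : ℕ

/-- The state after storing `x` in the cell with address `a`. -/
def State.store (s : State) (a x : ℕ) : State := { s with mem := Function.update s.mem a x }

/-- `Exec ω p s s' c`: with coin outcomes `ω`, the program `p` started in the state `s` halts in
the state `s'`, and the run costs `c`. Reading from an exhausted input tape yields `0`. -/
inductive Exec (ω : ℕ → Bool) : Prog → State → State → ℕ → Prop
  | assign (a e : Expr) (s : State) :
      Exec ω (.assign a e) s (s.store (a.eval s.mem) (e.eval s.mem))
        (1 + a.cost s.mem + e.cost s.mem)
  | read (a : Expr) (s : State) :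
      Exec ω (.read a) s { s.store (a.eval s.mem) (s.input.headD 0) with input := s.input.tail }
        (1 + a.cost s.mem + Nat.size (s.input.headD 0))
  | toss (a : Expr) (s : State) :
      Exec ω (.toss a) s
        { s.store (a.eval s.mem) (ω s.tossed).toNat with tossed := s.tossed + 1 }
        (1 + a.cost s.mem)
  | write (e : Expr) (s : State) :
      Exec ω (.write e) s { s with output := s.output ++ [e.eval s.mem] } (1 + e.cost s.mem)
  | seq {p q : Prog} {s s' s'' : State} {c c' : ℕ}
      (hp : Exec ω p s s' c) (hq : Exec ω q s' s'' c') :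
      Exec ω (.seq p q) s s'' (c + c')
  | iteTrue {e : Expr} {p q : Prog} {s s' : State} {c : ℕ}
      (he : e.eval s.mem ≠ 0) (hp : Exec ω p s s' c) :
      Exec ω (.ite e p q) s s' (1 + e.cost s.mem + c)
  | iteFalse {e : Expr} {p q : Prog} {s s' : State} {c : ℕ}
      (he : e.eval s.mem = 0) (hq : Exec ω q s s' c) :
      Exec ω (.ite e p q) s s' (1 + e.cost s.mem + c)
  | loopDone {e : Expr} {p : Prog} {s : State} (he : e.eval s.mem = 0) :
      Exec ω (.loop e p) s s (1 + e.cost s.mem)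
  | loopStep {e : Expr} {p : Prog} {s s' s'' : State} {c c' : ℕ}
      (he : e.eval s.mem ≠ 0) (hp : Exec ω p s s' c) (hl : Exec ω (.loop e p) s' s'' c') :
      Exec ω (.loop e p) s s'' (1 + e.cost s.mem + c + c')

/-- The initial state on input `x`: all memory cells hold `0`. -/
def init (x : List ℕ) : State := ⟨fun _ => 0, x, [], 0⟩

/-- On input `x` and with coin outcomes `ω`, the program `p` halts with output `y`, at cost `c`. -/
def Computes (p : Prog) (x : List ℕ) (ω : ℕ → Bool) (y : List ℕ) (c : ℕ) : Prop :=
  ∃ s : State, Exec ω p (init x) s c ∧ s.output = y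

/-- The distribution of an infinite sequence of independent fair coins. -/
noncomputable def fairCoins : Measure (ℕ → Bool) :=
  Measure.infinitePi fun _ => (PMF.uniformOfFintype Bool).toMeasure

end RAM

/-! The weights are compressed by multiply-shift hashing. Let `c` be such that every clique weight
differs from `t` by at most `2 ^ c`, put `R = c + 3n + 2`, draw `a` uniformly below `2 ^ R`, and
replace each weight `w` by `(a * w mod 2 ^ R) / 2 ^ c`, a number below `Λ = 2 ^ (3n + 2)`.

This map is additive only up to rounding and reduction modulo `Λ`. For a clique with at most `2 ^ n`
hyperedges, both defects are below `2 ^ n`: a rounding loss `r` and a wrap-around count. They are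
absorbed by `2n` slack vertices of weights `2 ^ i` and `Λ * 2 ^ i` with `i < n`; the target is the
hash of `t` plus `(2 ^ n - 1) * Λ`, so the wrap-around is compensated by adding its complement.
Since weights sit on hyperedges, a core of `d - 1` further vertices is added: the hyperedge
consisting of the core and a slack vertex carries the weight of that vertex. All `d`-sets meeting
the new vertices are hyperedges, so being a clique depends on the old part alone. Hence a
YES-instance stays one for every `a` (`isYes_reduce`, `isYes_hashed`).

Conversely, a solution of the new instance yields an old clique `S` for which `a * (w(S) - t)`
modulo `2 ^ R` lies in a fixed interval of length `2 ^ (c + n + 2)` (`exists_of_isYes_hashed`). If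
`w(S) ≠ t`, this has probability at most `2 ^ (-2n)` (`card_le_of_mul_mem_interval`,
`fairCoins_mul_mem_interval_le`), and a union bound over at most `2 ^ n` cliques leaves `2 ^ (-n)`
(`fairCoins_isYes_hashed_le`).

The reduction is written as an explicit machine program. Loop invariants give its output and bound
all cells, and `exists_bound_loop` turns such bounds into running times; `entry_hashed` identifies
the output with the encoding of the hashed instance. -/

/-! ### Cost of loop-free programs and of loops with an invariant -/

namespace RAM

/-- The result of running a loop-free program (loops are skipped). -/
def Prog.run (ω : ℕ → Bool) : Prog → State → State
  | .assign a e, s => s.store (a.eval s.mem) (e.eval s.mem)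
  | .read a, s => { s.store (a.eval s.mem) (s.input.headD 0) with input := s.input.tail }
  | .toss a, s => { s.store (a.eval s.mem) (ω s.tossed).toNat with tossed := s.tossed + 1 }
  | .write e, s => { s with output := s.output ++ [e.eval s.mem] }
  | .seq p q, s => q.run ω (p.run ω s)
  | .ite e p q, s => if e.eval s.mem ≠ 0 then p.run ω s else q.run ω s
  | .loop _ _, s => s

/-- The program contains no loop. -/
def Prog.LoopFree : Prog → Prop
  | .seq p q => p.LoopFree ∧ q.LoopFree
  | .ite _ p q => p.LoopFree ∧ q.LoopFree
  | .loop _ _ => False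
  | _ => True

/-- All memory cells and all remaining inputs have at most `Z` bits. -/
def State.Bdd (Z : ℕ) (s : State) : Prop :=
  (∀ a, Nat.size (s.mem a) ≤ Z) ∧ ∀ x ∈ s.input, Nat.size x ≤ Z

theorem size_add_le (x y : ℕ) : Nat.size (x + y) ≤ Nat.size x + Nat.size y := by
  rw [Nat.size_le, pow_add]
  have hx := Nat.lt_size_self x
  have hy := Nat.lt_size_self y
  calc x + y < (x + 1) * (y + 1) := by nlinarith [Nat.zero_le (x * y)]
    _ ≤ _ := Nat.mul_le_mul hx hy

theorem size_mul_le (x y : ℕ) : Nat.size (x * y) ≤ Nat.size x + Nat.size y := by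
  rw [Nat.size_le, pow_add]
  exact Nat.mul_lt_mul'' (Nat.lt_size_self x) (Nat.lt_size_self y)

theorem Op.size_eval_le (o : Op) (x y : ℕ) :
    Nat.size (o.eval x y) ≤ Nat.size x + Nat.size y := by
  cases o
  · exact size_add_le x y
  · exact (Nat.size_le_size (Nat.sub_le x y)).trans (Nat.le_add_right _ _)
  · exact size_mul_le x y
  · exact (Nat.size_le_size (Nat.div_le_self x y)).trans (Nat.le_add_right _ _)
  · exact (Nat.size_le_size (Nat.mod_le x y)).trans (Nat.le_add_right _ _)

/-- Bit length is subadditive under every operation, so value and cost grow linearly in the bound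
`Z` on the cells, with a factor depending only on the expression. -/
theorem Expr.exists_bound (e : Expr) : ∃ K, ∀ (M : ℕ → ℕ) (Z : ℕ), (∀ a, Nat.size (M a) ≤ Z) →
    Nat.size (e.eval M) ≤ K * (Z + 1) ∧ e.cost M ≤ K * (Z + 1) := by
  induction e with
  | lit c =>
    refine ⟨1 + Nat.size c, fun M Z _ => ?_⟩
    simp only [Expr.eval, Expr.cost]
    constructor <;> nlinarith [Nat.zero_le (Nat.size c * Z)]
  | cell a ih =>
    obtain ⟨K, hK⟩ := ih
    refine ⟨K + 1, fun M Z h => ?_⟩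
    have h1 := (hK M Z h).2
    have h2 := h (a.eval M)
    simp only [Expr.eval, Expr.cost]
    constructor <;> nlinarith
  | op o a b iha ihb =>
    obtain ⟨K, hK⟩ := iha
    obtain ⟨K', hK'⟩ := ihb
    refine ⟨2 * (K + K') + 1, fun M Z h => ?_⟩
    obtain ⟨h1, h2⟩ := hK M Z h
    obtain ⟨h3, h4⟩ := hK' M Z h
    have h5 := o.size_eval_le (a.eval M) (b.eval M)
    simp only [Expr.eval, Expr.cost]
    constructor <;> nlinarith

theorem State.Bdd.mono {Z Z' : ℕ} {s : State} (h : s.Bdd Z) (hZ : Z ≤ Z') : s.Bdd Z' :=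
  ⟨fun a => (h.1 a).trans hZ, fun x hx => (h.2 x hx).trans hZ⟩

theorem State.Bdd.update {Z : ℕ} {s : State} (h : s.Bdd Z) (a x : ℕ) (hx : Nat.size x ≤ Z)
    (b : ℕ) : Nat.size (Function.update s.mem a x b) ≤ Z := by
  by_cases hb : b = a
  · subst hb; simpa using hx
  · simpa [hb] using h.1 b

theorem Prog.exists_bound (p : Prog) (hp : p.LoopFree) :
    ∃ K, ∀ (ω : ℕ → Bool) (s : State) (Z : ℕ), s.Bdd Z →
      (p.run ω s).Bdd (K * (Z + 1)) ∧ ∃ c, Exec ω p s (p.run ω s) c ∧ c ≤ K * (Z + 1) := by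
  induction p with
  | assign a e =>
    obtain ⟨K, hK⟩ := a.exists_bound
    obtain ⟨K', hK'⟩ := e.exists_bound
    refine ⟨1 + K + K', fun ω s Z h => ⟨?_, _, .assign a e s, ?_⟩⟩
    · have h1 := (hK' s.mem Z h.1).1
      have h2 : s.Bdd ((1 + K + K') * (Z + 1)) := h.mono (by nlinarith [Nat.zero_le (K * Z), Nat.zero_le (K' * Z)])
      exact ⟨h2.update _ _ (h1.trans (by gcongr; omega)), h2.2⟩
    · nlinarith [(hK s.mem Z h.1).2, (hK' s.mem Z h.1).2]
  | read a =>
    obtain ⟨K, hK⟩ := a.exists_bound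
    refine ⟨2 + K, fun ω s Z h => ?_⟩
    have h1 : Nat.size (s.input.headD 0) ≤ Z := by
      cases hi : s.input with
      | nil => simp
      | cons x l => exact h.2 x (by simp [hi])
    have h2 : s.Bdd ((2 + K) * (Z + 1)) := h.mono (by nlinarith [Nat.zero_le (K * Z)])
    refine ⟨⟨h2.update _ _ (h1.trans (by nlinarith [Nat.zero_le (K * Z)])),
      fun x hx => h2.2 x (List.mem_of_mem_tail hx)⟩, _, .read a s, ?_⟩
    nlinarith [(hK s.mem Z h.1).2]
  | toss a =>
    obtain ⟨K, hK⟩ := a.exists_bound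
    refine ⟨1 + K, fun ω s Z h => ?_⟩
    have h2 : s.Bdd ((1 + K) * (Z + 1)) := h.mono (by nlinarith [Nat.zero_le (K * Z)])
    refine ⟨⟨h2.update _ _ ?_, h2.2⟩, _, .toss a s, ?_⟩
    · have : Nat.size (ω s.tossed).toNat ≤ 1 := by cases ω s.tossed <;> simp
      nlinarith [Nat.zero_le (K * Z)]
    · nlinarith [(hK s.mem Z h.1).2]
  | write e =>
    obtain ⟨K, hK⟩ := e.exists_bound
    refine ⟨1 + K, fun ω s Z h => ⟨h.mono (by nlinarith [Nat.zero_le (K * Z)]), _, .write e s, ?_⟩⟩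
    nlinarith [(hK s.mem Z h.1).2]
  | seq p q ihp ihq =>
    obtain ⟨K, hK⟩ := ihp hp.1
    obtain ⟨K', hK'⟩ := ihq hp.2
    refine ⟨K + K' * (K + 1), fun ω s Z h => ?_⟩
    obtain ⟨h1, c, hc, hc'⟩ := hK ω s Z h
    obtain ⟨h2, c2, hc2, hc2'⟩ := hK' ω _ _ h1
    have : K' * (K * (Z + 1) + 1) ≤ K' * (K + 1) * (Z + 1) := by
      rw [mul_assoc]; gcongr; nlinarith
    refine ⟨h2.mono (by nlinarith), _, .seq hc hc2, by nlinarith⟩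
  | ite e p q ihp ihq =>
    obtain ⟨K, hK⟩ := ihp hp.1
    obtain ⟨K', hK'⟩ := ihq hp.2
    obtain ⟨K'', hK''⟩ := e.exists_bound
    refine ⟨1 + K + K' + K'', fun ω s Z h => ?_⟩
    have he := (hK'' s.mem Z h.1).2
    by_cases h0 : e.eval s.mem ≠ 0
    · obtain ⟨h1, c, hc, hc'⟩ := hK ω s Z h
      simp only [Prog.run, h0, ne_eq, not_false_eq_true, if_true]
      exact ⟨h1.mono (by gcongr; omega), _, .iteTrue h0 hc, by nlinarith⟩
    · obtain ⟨h1, c, hc, hc'⟩ := hK' ω s Z h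
      simp only [Prog.run, h0, if_false]
      exact ⟨h1.mono (by gcongr; omega), _, .iteFalse (not_not.mp h0) hc, by nlinarith⟩
  | loop e p _ => exact hp.elim

/-- Iterating the loop-free bound would let the cell sizes grow geometrically; instead the invariant
supplies one bound `Z` for all iterations. The constant `K` is fixed before the invariant, the
number of rounds and `Z`, so it depends on the program alone. -/
theorem exists_bound_loop (e : Expr) (p : Prog) (hp : p.LoopFree) :
    ∃ K, ∀ (ω : ℕ → Bool) (n Z : ℕ) (Inv : ℕ → State → Prop) (s : State), Inv 0 s →
      (∀ i s, i ≤ n → Inv i s → s.Bdd Z) →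
      (∀ i s, i < n → Inv i s → e.eval s.mem ≠ 0 ∧ Inv (i + 1) (p.run ω s)) →
      (∀ s, Inv n s → e.eval s.mem = 0) →
      ∃ s' c, Exec ω (.loop e p) s s' c ∧ Inv n s' ∧ c ≤ K * ((n + 1) * (Z + 1)) := by
  obtain ⟨K, hK⟩ := p.exists_bound hp
  obtain ⟨K', hK'⟩ := e.exists_bound
  refine ⟨1 + K' + K, fun ω n Z Inv s h0 hb hs hn => ?_⟩
  suffices H : ∀ j i s, i + j = n → Inv i s →
      ∃ s' c, Exec ω (.loop e p) s s' c ∧ Inv n s' ∧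
        c ≤ (1 + K' + K) * ((j + 1) * (Z + 1)) from H n 0 s (by omega) h0
  intro j
  induction j with
  | zero =>
    intro i s hi h
    obtain rfl : i = n := by omega
    refine ⟨s, _, .loopDone (hn s h), h, ?_⟩
    nlinarith [(hK' s.mem Z (hb _ s le_rfl h).1).2, Nat.zero_le (K * Z)]
  | succ j ih =>
    intro i s hi h
    obtain ⟨h1, h2⟩ := hs i s (by omega) h
    have hbs := hb i s (by omega) h
    obtain ⟨_, c, hc, hc'⟩ := hK ω s Z hbs
    obtain ⟨s', c', he, hi', hc''⟩ := ih (i + 1) _ (by omega) h2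
    refine ⟨s', _, .loopStep h1 hc he, hi', ?_⟩
    nlinarith [(hK' s.mem Z hbs.1).2]

end RAM

/-! ### Random multipliers modulo a power of two -/

namespace RAM

/-- The number with binary digits `ω 0, …, ω (R - 1)`, the most significant one first. -/
def coinNumber (ω : ℕ → Bool) : ℕ → ℕ
  | 0 => 0
  | R + 1 => 2 * coinNumber ω R + (ω R).toNat

theorem coinNumber_lt (ω : ℕ → Bool) (R : ℕ) : coinNumber ω R < 2 ^ R := by
  induction R with
  | zero => simp [coinNumber]
  | succ R ih =>
    have := Bool.toNat_le (ω R)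
    simp only [coinNumber, pow_succ]
    omega

theorem coinNumber_injOn {ω ω' : ℕ → Bool} {R : ℕ} (h : coinNumber ω R = coinNumber ω' R) :
    ∀ i < R, ω i = ω' i := by
  induction R with
  | zero => intro i hi; omega
  | succ R ih =>
    simp only [coinNumber] at h
    have h1 := Bool.toNat_le (ω R)
    have h2 := Bool.toNat_le (ω' R)
    intro i hi
    rcases Nat.lt_succ_iff_lt_or_eq.mp hi with hi | rfl
    · exact ih (by omega) i hi
    · have : (ω i).toNat = (ω' i).toNat := by omega
      cases hω : ω i <;> cases hω' : ω' i <;> simp_all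

instance : IsProbabilityMeasure fairCoins := by
  unfold fairCoins; infer_instance

/-- The value determines the first `R` coins, so the event lies in a cylinder with `R` fixed
coordinates. -/
theorem fairCoins_coinNumber_eq_le (R v : ℕ) :
    fairCoins {ω | coinNumber ω R = v} ≤ (2⁻¹ : ENNReal) ^ R := by
  by_cases h : ∃ ω₀, coinNumber ω₀ R = v
  · obtain ⟨ω₀, h₀⟩ := h
    have hsub : {ω | coinNumber ω R = v} ⊆
        ((Finset.range R : Finset ℕ) : Set ℕ).pi fun i => {ω₀ i} := by
      intro ω hω i hi
      exact coinNumber_injOn (hω.trans h₀.symm) i (by simpa using hi)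
    refine (measure_mono hsub).trans ?_
    unfold fairCoins
    rw [Measure.infinitePi_pi _ fun _ _ => measurableSet_singleton _]
    simp
  · have : {ω | coinNumber ω R = v} = ∅ := by
      ext ω; simpa using fun hω => h ⟨ω, hω⟩
    simp [this]

/-- The gcd of `x` and `2 ^ R` is a power of two not exceeding `|x| ≤ 2 ^ q`, hence divides `2 ^ q`;
Bézout gives `δ`. -/
theorem exists_mul_eq_two_pow {R q : ℕ} {x : ℤ} (hx : x ≠ 0) (hxq : x.natAbs ≤ 2 ^ q) :
    ∃ δ : ZMod (2 ^ R), δ * (x : ZMod (2 ^ R)) = 2 ^ q := by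
  have h1 : Int.gcd x ((2 ^ R : ℕ) : ℤ) ∣ 2 ^ q := by
    have h2 : Int.gcd x ((2 ^ R : ℕ) : ℤ) ∣ 2 ^ R := by
      have := Int.gcd_dvd_natAbs_right x ((2 ^ R : ℕ) : ℤ)
      rwa [Int.natAbs_natCast] at this
    have h3 : Int.gcd x ((2 ^ R : ℕ) : ℤ) ≤ 2 ^ q :=
      (Nat.le_of_dvd (Int.natAbs_pos.mpr hx) (Int.gcd_dvd_natAbs_left x _)).trans hxq
    obtain ⟨s, -, hs⟩ := (Nat.dvd_prime_pow Nat.prime_two).mp h2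
    rw [hs] at h3 ⊢
    exact pow_dvd_pow 2 ((Nat.pow_le_pow_iff_right (by norm_num)).mp h3)
  obtain ⟨y, z, hyz⟩ := Int.gcd_dvd_iff.mp h1
  refine ⟨y, ?_⟩
  have := congrArg (Int.cast : ℤ → ZMod (2 ^ R)) hyz
  rw [Int.cast_add, Int.cast_mul, Int.cast_mul, Int.cast_natCast, Int.cast_natCast,
    ZMod.natCast_self, zero_mul, add_zero, Nat.cast_pow, Nat.cast_ofNat] at this
  rw [this, mul_comm]

/-- Take `δ` with `δ * x = 2 ^ q`. Multiplication by `x` sends the translate `F + j * δ` into the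
interval of length `2 ^ q` starting at `u + j * 2 ^ q`. For `j < 2 ^ (R - q)` these intervals are
disjoint, so the translates are disjoint too, and together they fit into `2 ^ R` residues. -/
theorem card_le_of_mul_mem_interval {R q : ℕ} (hq : q ≤ R) {x : ℤ} (hx : x ≠ 0)
    (hxq : x.natAbs ≤ 2 ^ q) (u : ZMod (2 ^ R)) (F : Finset ℕ) (hF : ∀ a ∈ F, a < 2 ^ R)
    (h : ∀ a ∈ F, ∃ i < 2 ^ q, (a : ZMod (2 ^ R)) * x = u + (i : ℕ)) : F.card ≤ 2 ^ q := by
  obtain ⟨δ, hδ⟩ := exists_mul_eq_two_pow (R := R) hx hxq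
  have : NeZero (2 ^ R) := ⟨by positivity⟩
  have hcast : ∀ {a b : ℕ}, a < 2 ^ R → b < 2 ^ R → (a : ZMod (2 ^ R)) = b → a = b := by
    intro a b ha hb hab
    have := (ZMod.natCast_eq_natCast_iff' _ _ _).mp hab
    rwa [Nat.mod_eq_of_lt ha, Nat.mod_eq_of_lt hb] at this
  have hR : 2 ^ R = 2 ^ q * 2 ^ (R - q) := by rw [← pow_add]; congr 1; omega
  have hcard : (F ×ˢ Finset.range (2 ^ (R - q))).card ≤
      (Finset.univ : Finset (ZMod (2 ^ R))).card := by
    refine Finset.card_le_card_of_injOn (fun p => (p.1 : ZMod (2 ^ R)) + p.2 * δ)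
      (fun _ _ => Finset.mem_coe.mpr (Finset.mem_univ _)) ?_
    rintro ⟨a, j⟩ ha ⟨b, k⟩ hb hab
    simp only [Finset.coe_product, Set.mem_prod, Finset.mem_coe, Finset.mem_range] at ha hb hab
    obtain ⟨i, hi, hai⟩ := h a ha.1
    obtain ⟨i', hi', hbi⟩ := h b hb.1
    have h1 : ((i + j * 2 ^ q : ℕ) : ZMod (2 ^ R)) = ((i' + k * 2 ^ q : ℕ) : ZMod (2 ^ R)) := by
      have := congrArg (· * (x : ZMod (2 ^ R))) hab
      simp only [add_mul, mul_assoc, hδ, hai, hbi] at this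
      push_cast
      rw [add_assoc, add_assoc] at this
      exact add_left_cancel this
    have hlt : ∀ {i j : ℕ}, i < 2 ^ q → j < 2 ^ (R - q) → i + j * 2 ^ q < 2 ^ R := by
      intro i j hi hj
      rw [hR]
      calc i + j * 2 ^ q < 2 ^ q + j * 2 ^ q := by omega
        _ = 2 ^ q * (j + 1) := by ring
        _ ≤ _ := Nat.mul_le_mul_left _ hj
    have h2 := hcast (hlt hi ha.2) (hlt hi' hb.2) h1
    have hjk : j = k := by
      have := congrArg (· / 2 ^ q) h2
      simpa [Nat.add_mul_div_right, Nat.div_eq_of_lt hi, Nat.div_eq_of_lt hi'] using this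
    subst hjk
    have := hcast (hF a ha.1) (hF b hb.1) (add_right_cancel hab)
    rw [this]
  rw [Finset.card_product, Finset.card_range, Finset.card_univ, ZMod.card] at hcard
  rw [hR] at hcard
  exact Nat.le_of_mul_le_mul_right hcard (by positivity)

theorem fairCoins_mul_mem_interval_le {R q : ℕ} (hq : q ≤ R) {x : ℤ} (hx : x ≠ 0)
    (hxq : x.natAbs ≤ 2 ^ q) (u : ZMod (2 ^ R)) :
    fairCoins {ω | ∃ i < 2 ^ q, (coinNumber ω R : ZMod (2 ^ R)) * x = u + (i : ℕ)} ≤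
      2 ^ q * (2⁻¹ : ENNReal) ^ R := by
  classical
  set F : Finset ℕ := (Finset.range (2 ^ R)).filter fun a =>
    ∃ i < 2 ^ q, (a : ZMod (2 ^ R)) * x = u + (i : ℕ) with hF
  have hsub : {ω | ∃ i < 2 ^ q, (coinNumber ω R : ZMod (2 ^ R)) * x = u + (i : ℕ)} ⊆
      ⋃ a ∈ F, {ω | coinNumber ω R = a} := by
    intro ω hω
    simp only [Set.mem_iUnion, Set.mem_ofPred_eq, exists_prop, exists_eq_right']
    exact Finset.mem_filter.mpr ⟨Finset.mem_range.mpr (coinNumber_lt ω R), hω⟩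
  have hcard : F.card ≤ 2 ^ q := card_le_of_mul_mem_interval hq hx hxq u F
    (fun a ha => Finset.mem_range.mp (Finset.mem_filter.mp ha).1)
    (fun a ha => (Finset.mem_filter.mp ha).2)
  calc _ ≤ fairCoins (⋃ a ∈ F, {ω | coinNumber ω R = a}) := measure_mono hsub
    _ ≤ ∑ a ∈ F, fairCoins {ω | coinNumber ω R = a} := measure_biUnion_finset_le _ _
    _ ≤ ∑ _a ∈ F, (2⁻¹ : ENNReal) ^ R := Finset.sum_le_sum fun a _ => fairCoins_coinNumber_eq_le R a
    _ = F.card * (2⁻¹ : ENNReal) ^ R := by rw [Finset.sum_const, nsmul_eq_mul]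
    _ ≤ _ := by gcongr; exact_mod_cast hcard

end RAM

/-! ### Slack weights and binary expansions -/

/-- The weights `2 ^ i` and `2 ^ (3 * n + 2) * 2 ^ i` for `i < n`, in this order. -/
def slackWeight (n i : ℕ) : ℕ := if i < n then 2 ^ i else 2 ^ (2 * n + 2 + i)

theorem slackWeight_add (n i : ℕ) : slackWeight n (n + i) = 2 ^ (3 * n + 2) * 2 ^ i := by
  rw [slackWeight, if_neg (by omega), ← pow_add]; congr 1; omega

/-- The weight associated to a vertex of the reduced instance. -/
def vertexWeight (d n v : ℕ) : ℕ :=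
  if v < n + (d - 1) then 0 else slackWeight n (v - (n + (d - 1)))

theorem vertexWeight_add (d n i : ℕ) : vertexWeight d n (n + (d - 1) + i) = slackWeight n i := by
  rw [vertexWeight, if_neg (by omega)]; congr 1; omega

theorem exists_sum_two_pow {n r : ℕ} (h : r < 2 ^ n) :
    ∃ A ⊆ Finset.range n, ∑ i ∈ A, 2 ^ i = r := by
  induction n generalizing r with
  | zero => exact ⟨∅, by simp, by simp at h; simp [h]⟩
  | succ n ih =>
    by_cases hr : r < 2 ^ n
    · obtain ⟨A, hA, hs⟩ := ih hr
      exact ⟨A, hA.trans (Finset.range_subset_range.mpr (Nat.le_succ n)), hs⟩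
    · obtain ⟨A, hA, hs⟩ := ih (r := r - 2 ^ n) (by rw [pow_succ] at h; omega)
      have hn : n ∉ A := fun hn => by simpa using hA hn
      refine ⟨insert n A, ?_, ?_⟩
      · intro i hi
        rcases Finset.mem_insert.mp hi with rfl | hi
        · simp
        · have := Finset.mem_range.mp (hA hi); simp; omega
      · rw [Finset.sum_insert hn, hs]; omega

theorem exists_sum_slackWeight {n r k : ℕ} (hr : r < 2 ^ n) (hk : k < 2 ^ n) :
    ∃ A ⊆ Finset.range (2 * n), ∑ i ∈ A, slackWeight n i = r + k * 2 ^ (3 * n + 2) := by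
  obtain ⟨A, hA, hAs⟩ := exists_sum_two_pow hr
  obtain ⟨B, hB, hBs⟩ := exists_sum_two_pow hk
  have hd : Disjoint A (B.map (addLeftEmbedding n)) := by
    rw [Finset.disjoint_left]
    intro i hi hi'
    obtain ⟨j, -, rfl⟩ := Finset.mem_map.mp hi'
    have := Finset.mem_range.mp (hA hi)
    simp at this
  refine ⟨A ∪ B.map (addLeftEmbedding n), ?_, ?_⟩
  · refine Finset.union_subset (hA.trans (Finset.range_subset_range.mpr (by omega))) ?_
    intro i hi
    obtain ⟨j, hj, rfl⟩ := Finset.mem_map.mp hi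
    have := Finset.mem_range.mp (hB hj)
    simp; omega
  · rw [Finset.sum_union hd, Finset.sum_map]
    simp only [addLeftEmbedding_apply, slackWeight_add]
    rw [← Finset.mul_sum, hBs, ← hAs, mul_comm]
    congr 1
    refine Finset.sum_congr rfl fun i hi => ?_
    rw [slackWeight, if_pos (Finset.mem_range.mp (hA hi))]

/-! ### The reduced instance and the weights of its cliques -/

namespace EEWInstance

variable {d : ℕ}

/-- The weight of a set of vertices, `0` if it is not a hyperedge. -/
def wt (I : EEWInstance d) (e : Finset (Fin I.n)) : ℕ :=
  if h : e ∈ I.edges then I.weight ⟨e, h⟩ else 0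

theorem weightOf_eq (I : EEWInstance d) (S : Finset (Fin I.n)) :
    I.weightOf S = ∑ e ∈ I.edges with e ⊆ S, I.wt e := by
  rw [weightOf, Finset.sum_filter, Finset.sum_filter, ← Finset.sum_coe_sort I.edges]
  refine Finset.sum_congr rfl fun e _ => ?_
  simp [wt]

theorem entry_eq (I : EEWInstance d) (v : Fin d → Fin I.n) :
    I.entry v = if Finset.univ.image v ∈ I.edges then I.wt (Finset.univ.image v) + 1 else 0 := by
  unfold entry wt
  split_ifs <;> rfl

/-- The number of vertices of the reduced instance. -/
abbrev reducedSize (d n : ℕ) : ℕ := n + (d - 1 + 2 * n)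

/-- The vertices of the reduced instance that all slack hyperedges have in common. -/
def core (d n : ℕ) : Finset (Fin (reducedSize d n)) :=
  Finset.univ.filter fun v => n ≤ v.val ∧ v.val < n + (d - 1)

/-- The original vertices in a set of vertices of the reduced instance. -/
def pull {d n : ℕ} (S : Finset (Fin (reducedSize d n))) : Finset (Fin n) :=
  Finset.univ.filter fun v => Fin.castAdd _ v ∈ S

/-- The hyperedges of the reduced instance: the original ones, and all sets of size `d` with a new
vertex. -/
def reducedEdges (I : EEWInstance d) : Finset (Finset (Fin (reducedSize d I.n))) :=
  Finset.univ.filter fun e => e.card = d ∧ ((∀ v ∈ e, v.val < I.n) → pull e ∈ I.edges)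

/-- The reduced instance: the original weights are transformed by `f`, all sets of size `d` with a
new vertex are hyperedges, and those containing `core` have the weight of the remaining vertex. -/
abbrev reduce (I : EEWInstance d) (f : ℕ → ℕ) (τ : ℕ) : EEWInstance d where
  n := reducedSize d I.n
  edges := I.reducedEdges
  uniform := fun _ he => (Finset.mem_filter.mp he).2.1
  weight := fun e =>
    if ∀ v ∈ e.1, v.val < I.n then f (I.wt (pull e.1))
    else if core d I.n ⊆ e.1 then ∑ v ∈ e.1, vertexWeight d I.n v.val else 0
  target := τ

theorem mem_edges_reduce (I : EEWInstance d) (f : ℕ → ℕ) (τ : ℕ)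
    (e : Finset (Fin (reducedSize d I.n))) : e ∈ (I.reduce f τ).edges ↔
      e.card = d ∧ ((∀ v ∈ e, v.val < I.n) → pull e ∈ I.edges) := by
  simp [reducedEdges]

theorem wt_reduce (I : EEWInstance d) (f : ℕ → ℕ) (τ : ℕ)
    {e : Finset (Fin (reducedSize d I.n))} (he : e ∈ (I.reduce f τ).edges) :
    (I.reduce f τ).wt e = if ∀ v ∈ e, v.val < I.n then f (I.wt (pull e))
      else if core d I.n ⊆ e then ∑ v ∈ e, vertexWeight d I.n v.val else 0 := by
  rw [wt, dif_pos he]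

theorem pull_map {n : ℕ} (e : Finset (Fin n)) :
    pull (d := d) (e.map (Fin.castAddEmb _)) = e := by
  ext v; simp [pull]

theorem map_pull {n : ℕ} (e : Finset (Fin (reducedSize d n))) (h : ∀ v ∈ e, v.val < n) :
    (pull e).map (Fin.castAddEmb _) = e := by
  ext v
  simp only [Finset.mem_map, pull, Finset.mem_filter, Finset.mem_univ, true_and,
    Fin.castAddEmb_apply]
  constructor
  · rintro ⟨u, hu, rfl⟩; exact hu
  · intro hv; exact ⟨⟨v.val, h v hv⟩, hv, rfl⟩

theorem card_core (d n : ℕ) : (core d n).card = d - 1 := by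
  have : core d n = (Finset.univ : Finset (Fin (d - 1))).map
      ((Fin.castAddEmb (2 * n)).trans (Fin.natAddEmb n)) := by
    ext v
    simp only [core, Finset.mem_filter, Finset.mem_univ, true_and, Finset.mem_map,
      Function.Embedding.trans_apply, Fin.castAddEmb_apply, Fin.natAddEmb_apply]
    constructor
    · rintro ⟨h1, h2⟩
      exact ⟨⟨v.val - n, by omega⟩, Fin.ext (by simp; omega)⟩
    · rintro ⟨u, rfl⟩; simp
  rw [this, Finset.card_map, Finset.card_univ, Fintype.card_fin]

theorem vertexWeight_core {d n : ℕ} {v : Fin (reducedSize d n)} (hv : v ∈ core d n) :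
    vertexWeight d n v.val = 0 := by
  rw [vertexWeight, if_pos (Finset.mem_filter.mp hv).2.2]

/-- For `d ≥ 2` the core is nonempty, so hyperedges that carry slack weight are never old ones. -/
theorem not_forall_lt_of_core_subset (hd : 2 ≤ d) {n : ℕ} {e : Finset (Fin (reducedSize d n))}
    (h : core d n ⊆ e) : ¬ ∀ v ∈ e, v.val < n := by
  intro hlt
  have hc : (core d n).Nonempty := by
    rw [← Finset.card_pos, card_core]; omega
  obtain ⟨v, hv⟩ := hc
  have := (Finset.mem_filter.mp hv).2.1
  have := hlt v (h hv)
  omega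

theorem sum_old_reduce (I : EEWInstance d) (f : ℕ → ℕ) (τ : ℕ)
    (S : Finset (Fin (reducedSize d I.n))) :
    ∑ e ∈ (I.reduce f τ).edges.filter (· ⊆ S) with ∀ v ∈ e, v.val < I.n, (I.reduce f τ).wt e =
      ∑ e ∈ I.edges with e ⊆ pull S, f (I.wt e) := by
  refine Finset.sum_nbij' (fun e => pull (d := d) (n := I.n) e)
    (fun e => e.map (Fin.castAddEmb _)) ?_ ?_ ?_ ?_ ?_
  · intro e he
    simp only [Finset.mem_filter] at he
    obtain ⟨⟨he, heS⟩, hlt⟩ := he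
    refine Finset.mem_filter.mpr ⟨((mem_edges_reduce I f τ e).mp he).2 hlt, ?_⟩
    intro v hv
    simp only [pull, Finset.mem_filter, Finset.mem_univ, true_and] at hv ⊢
    exact heS hv
  · intro e he
    obtain ⟨he, heS⟩ := Finset.mem_filter.mp he
    have hlt : ∀ v ∈ e.map (Fin.castAddEmb (d - 1 + 2 * I.n)), v.val < I.n := by
      intro v hv
      obtain ⟨u, -, rfl⟩ := Finset.mem_map.mp hv
      simp
    simp only [Finset.mem_filter]
    refine ⟨⟨(mem_edges_reduce I f τ _).mpr ⟨?_, fun _ => ?_⟩, ?_⟩, hlt⟩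
    · rw [Finset.card_map, I.uniform e he]
    · rwa [pull_map]
    · intro v hv
      obtain ⟨u, hu, rfl⟩ := Finset.mem_map.mp hv
      exact (Finset.mem_filter.mp (heS hu)).2
  · intro e he
    exact map_pull e (Finset.mem_filter.mp he).2
  · intro e _
    exact pull_map e
  · intro e he
    obtain ⟨he, hlt⟩ := Finset.mem_filter.mp he
    rw [wt_reduce I f τ (Finset.mem_filter.mp he).1, if_pos hlt]

/-- Only `d`-sets containing the core contribute, and these are the core plus one vertex `v`. The
core and the old vertices have vertex weight `0`, so summing over all of `S` counts exactly the
slack vertices. -/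
theorem sum_new_reduce (hd : 2 ≤ d) (I : EEWInstance d) (f : ℕ → ℕ) (τ : ℕ)
    (S : Finset (Fin (reducedSize d I.n))) :
    ∑ e ∈ (I.reduce f τ).edges.filter (· ⊆ S) with ¬ ∀ v ∈ e, v.val < I.n,
      (I.reduce f τ).wt e =
      if core d I.n ⊆ S then ∑ v ∈ S, vertexWeight d I.n v.val else 0 := by
  have h1 : ∑ e ∈ (I.reduce f τ).edges.filter (· ⊆ S) with ¬ ∀ v ∈ e, v.val < I.n,
      (I.reduce f τ).wt e =
      ∑ e : Finset (Fin (reducedSize d I.n)) with (e ⊆ S ∧ e.card = d) ∧ core d I.n ⊆ e,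
        ∑ v ∈ e, vertexWeight d I.n v.val := by
    rw [← Finset.filter_filter _ (fun e => core d I.n ⊆ e), Finset.sum_filter (fun e => core d I.n ⊆ e)]
    symm
    have hsub : ((I.reduce f τ).edges.filter (· ⊆ S)).filter
        (fun e => ¬ ∀ v ∈ e, v.val < I.n) ⊆
        Finset.univ.filter fun e : Finset (Fin (reducedSize d I.n)) => e ⊆ S ∧ e.card = d := by
      intro e he
      simp only [Finset.mem_filter] at he
      exact Finset.mem_filter.mpr
        ⟨Finset.mem_univ _, he.1.2, ((mem_edges_reduce I f τ e).mp he.1.1).1⟩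
    rw [← Finset.sum_subset hsub]
    · refine Finset.sum_congr rfl fun e he => ?_
      simp only [Finset.mem_filter] at he
      rw [wt_reduce I f τ he.1.1, if_neg he.2]
    · intro e he hne
      obtain ⟨-, heS, hec⟩ := Finset.mem_filter.mp he
      rw [if_neg]
      intro hcore
      have hlt := not_forall_lt_of_core_subset hd hcore
      refine hne (Finset.mem_filter.mpr ⟨Finset.mem_filter.mpr ⟨?_, heS⟩, hlt⟩)
      exact (mem_edges_reduce I f τ e).mpr ⟨hec, fun h => absurd h hlt⟩
  rw [h1]
  split_ifs with hS
  · rw [← Finset.sum_sdiff hS, Finset.sum_eq_zero (s := core d I.n)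
      (fun v hv => vertexWeight_core hv), add_zero]
    symm
    have hins : ∀ v ∈ S \ core d I.n, v ∉ core d I.n := fun v hv => (Finset.mem_sdiff.mp hv).2
    refine Finset.sum_bij (fun v _ => insert v (core d I.n)) ?_ ?_ ?_ ?_
    · intro v hv
      refine Finset.mem_filter.mpr ⟨Finset.mem_univ _, ⟨?_, ?_⟩, Finset.subset_insert _ _⟩
      · exact Finset.insert_subset (Finset.mem_sdiff.mp hv).1 hS
      · rw [Finset.card_insert_of_notMem (hins v hv), card_core]; omega
    · intro v hv w hw hvw
      exact (Finset.insert_inj (hins v hv)).mp hvw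
    · intro e he
      obtain ⟨-, ⟨heS, hec⟩, hce⟩ := Finset.mem_filter.mp he
      have hcard : (e \ core d I.n).card = 1 := by
        rw [Finset.card_sdiff_of_subset hce, card_core]; omega
      obtain ⟨v, hv⟩ := Finset.card_eq_one.mp hcard
      have hv' : v ∈ e \ core d I.n := by rw [hv]; exact Finset.mem_singleton_self v
      refine ⟨v, Finset.mem_sdiff.mpr ⟨heS (Finset.mem_sdiff.mp hv').1,
        (Finset.mem_sdiff.mp hv').2⟩, ?_⟩
      rw [Finset.insert_eq, ← hv, Finset.sdiff_union_of_subset hce]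
    · intro v hv
      rw [Finset.sum_insert (hins v hv), Finset.sum_eq_zero (s := core d I.n)
        (fun v hv => vertexWeight_core hv), add_zero]
  · refine Finset.sum_eq_zero fun e he => ?_
    obtain ⟨-, ⟨heS, -⟩, hce⟩ := Finset.mem_filter.mp he
    exact absurd (hce.trans heS) hS

theorem weightOf_reduce (hd : 2 ≤ d) (I : EEWInstance d) (f : ℕ → ℕ) (τ : ℕ)
    (S : Finset (Fin (reducedSize d I.n))) :
    (I.reduce f τ).weightOf S = (∑ e ∈ I.edges with e ⊆ pull S, f (I.wt e)) +
      if core d I.n ⊆ S then ∑ v ∈ S, vertexWeight d I.n v.val else 0 := by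
  rw [weightOf_eq, ← sum_old_reduce I f τ S, ← sum_new_reduce hd I f τ S]
  exact (Finset.sum_filter_add_sum_filter_not _ _ _).symm

/-- The low slack weights sum to less than `2 ^ n`, and all high ones are multiples of `2 ^ (3 * n +
2)`. -/
theorem exists_sum_vertexWeight {n : ℕ} (S : Finset (Fin (reducedSize d n))) :
    ∃ r < 2 ^ n, ∃ k, ∑ v ∈ S, vertexWeight d n v.val = r + k * 2 ^ (3 * n + 2) := by
  have hdvd : 2 ^ (3 * n + 2) ∣
      ∑ v ∈ S with ¬ v.val < n + (d - 1) + n, vertexWeight d n v.val := by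
    refine Finset.dvd_sum fun v hv => ?_
    have hv := (Finset.mem_filter.mp hv).2
    obtain ⟨i, hi⟩ : ∃ i, v.val = n + (d - 1) + (n + i) := ⟨v.val - (n + (d - 1) + n), by omega⟩
    rw [hi, vertexWeight_add, slackWeight_add]
    exact dvd_mul_right _ _
  obtain ⟨k, hk⟩ := hdvd
  refine ⟨∑ v ∈ S with v.val < n + (d - 1) + n, vertexWeight d n v.val, ?_, k, ?_⟩
  · have h1 : ∑ v ∈ S with v.val < n + (d - 1) + n, vertexWeight d n v.val ≤
        ∑ i ∈ Finset.range (n + (d - 1) + n), vertexWeight d n i := by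
      refine (Finset.sum_map _ Fin.valEmbedding (fun i => vertexWeight d n i)).symm.trans_le ?_
      refine Finset.sum_le_sum_of_subset fun i hi => ?_
      obtain ⟨v, hv, rfl⟩ := Finset.mem_map.mp hi
      exact Finset.mem_range.mpr (Finset.mem_filter.mp hv).2
    refine h1.trans_lt ?_
    rw [Finset.sum_range_add, Finset.sum_eq_zero, zero_add]
    · rw [Finset.sum_congr rfl (g := fun i => 2 ^ i)]
      · rw [Nat.geomSum_eq le_rfl]
        have : 0 < 2 ^ n := by positivity
        simp
      · intro i hi
        rw [vertexWeight_add, slackWeight, if_pos (Finset.mem_range.mp hi)]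
    · intro i hi
      rw [vertexWeight, if_pos (Finset.mem_range.mp hi)]
  · rw [mul_comm k, ← hk, Finset.sum_filter_add_sum_filter_not]

/-- No bound on `k` is needed: its term disappears modulo `2 ^ R` once the equation is scaled by `2
^ c`. -/
theorem exists_of_isYes_reduce (hd : 2 ≤ d) {I : EEWInstance d} {f : ℕ → ℕ} {τ : ℕ}
    (h : (I.reduce f τ).IsYes) : ∃ S, I.IsHyperclique S ∧ ∃ r < 2 ^ I.n, ∃ k,
      (∑ e ∈ I.edges with e ⊆ S, f (I.wt e)) + (r + k * 2 ^ (3 * I.n + 2)) = τ := by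
  obtain ⟨S, hS, hw⟩ := h
  refine ⟨pull (d := d) (n := I.n) S, ?_, ?_⟩
  · intro e he hec
    have hlt : ∀ v ∈ e.map (Fin.castAddEmb (d - 1 + 2 * I.n)), v.val < I.n := by
      intro v hv
      obtain ⟨u, -, rfl⟩ := Finset.mem_map.mp hv
      simp
    have := hS (e.map (Fin.castAddEmb _)) (fun v hv => by
      obtain ⟨u, hu, rfl⟩ := Finset.mem_map.mp hv
      exact (Finset.mem_filter.mp (he hu)).2) (by rw [Finset.card_map, hec])
    have := ((mem_edges_reduce I f τ _).mp this).2 hlt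
    rwa [pull_map] at this
  · rw [weightOf_reduce hd] at hw
    split_ifs at hw
    · obtain ⟨r, hr, k, hk⟩ := exists_sum_vertexWeight (d := d) (n := I.n) S
      exact ⟨r, hr, k, by rw [← hk]; exact hw⟩
    -- A solution may omit part of the core; then no slack weight is collected.
    · exact ⟨0, by positivity, 0, by simpa using hw⟩

/-- The clique is `S` together with the core and the slack vertices given by the binary digits of
`r` and `k`. Only its `d`-subsets of old vertices need the hypothesis on `S`. -/
theorem isYes_reduce (hd : 2 ≤ d) {I : EEWInstance d} {f : ℕ → ℕ} {τ r k : ℕ}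
    {S : Finset (Fin I.n)} (hS : I.IsHyperclique S) (hr : r < 2 ^ I.n) (hk : k < 2 ^ I.n)
    (h : (∑ e ∈ I.edges with e ⊆ S, f (I.wt e)) + (r + k * 2 ^ (3 * I.n + 2)) = τ) :
    (I.reduce f τ).IsYes := by
  obtain ⟨A, hA, hAs⟩ := exists_sum_slackWeight hr hk
  set X : Finset (Fin (reducedSize d I.n)) := Finset.univ.filter fun v =>
    (∃ h : v.val < I.n, (⟨v.val, h⟩ : Fin I.n) ∈ S) ∨ (I.n ≤ v.val ∧ v.val < I.n + (d - 1)) ∨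
      (I.n + (d - 1) ≤ v.val ∧ v.val - (I.n + (d - 1)) ∈ A) with hX
  have hpull : pull (d := d) (n := I.n) X = S := by
    ext v
    simp only [pull, hX, Finset.mem_filter, Finset.mem_univ, true_and, Fin.val_castAdd]
    constructor
    · rintro (⟨_, h⟩ | h | h)
      · exact h
      · omega
      · omega
    · intro h; exact Or.inl ⟨v.2, h⟩
  have hcore : core d I.n ⊆ X := by
    intro v hv
    exact Finset.mem_filter.mpr ⟨Finset.mem_univ _, Or.inr (Or.inl (Finset.mem_filter.mp hv).2)⟩
  refine ⟨X, ?_, ?_⟩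
  · intro e he hec
    refine (mem_edges_reduce I f τ e).mpr ⟨hec, fun hlt => hS _ ?_ ?_⟩
    · rw [← hpull]
      intro v hv
      simp only [pull, Finset.mem_filter, Finset.mem_univ, true_and] at hv ⊢
      exact he hv
    · rw [← Finset.card_map (Fin.castAddEmb (d - 1 + 2 * I.n)), map_pull e hlt, hec]
  · rw [weightOf_reduce hd, hpull, if_pos hcore]
    change _ = τ
    rw [← h, ← hAs]
    congr 1
    have h0 : ∑ v ∈ X with v.val < I.n + (d - 1), vertexWeight d I.n v.val = 0 :=
      Finset.sum_eq_zero fun v hv => by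
        rw [vertexWeight, if_pos (Finset.mem_filter.mp hv).2]
    rw [← Finset.sum_filter_add_sum_filter_not X fun v => v.val < I.n + (d - 1), h0, zero_add]
    refine Finset.sum_bij (fun v _ => v.val - (I.n + (d - 1))) ?_ ?_ ?_ ?_
    · intro v hv
      simp only [hX, Finset.mem_filter, Finset.mem_univ, true_and] at hv
      obtain ⟨⟨h, -⟩ | h | h, hv⟩ := hv
      · omega
      · omega
      · exact h.2
    · intro v hv w hw hvw
      have := (Finset.mem_filter.mp hv).2
      have := (Finset.mem_filter.mp hw).2
      exact Fin.ext (by omega)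
    · intro i hi
      have := Finset.mem_range.mp (hA hi)
      refine ⟨⟨I.n + (d - 1) + i, by simp only [reducedSize]; omega⟩, ?_, by simp⟩
      simp only [hX, Finset.mem_filter, Finset.mem_univ, true_and]
      refine ⟨Or.inr (Or.inr ⟨by omega, ?_⟩), by omega⟩
      rwa [Nat.add_sub_cancel_left]
    · intro v hv
      have := (Finset.mem_filter.mp hv).2
      rw [vertexWeight, if_neg this]

end EEWInstance

/-! ### Completeness and soundness of the hashed instance -/

namespace EEWInstance

variable {d : ℕ}

/-- The weight `w` multiplied by `a` modulo `2 ^ (c + (3 * n + 2))`, without its last `c` bits. -/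
def hashWeight (n a c w : ℕ) : ℕ := a * w % 2 ^ (c + (3 * n + 2)) / 2 ^ c

/-- The reduced instance with hashed weights. -/
abbrev hashed (I : EEWInstance d) (a c : ℕ) : EEWInstance d :=
  I.reduce (hashWeight I.n a c)
    (hashWeight I.n a c I.target + (2 ^ I.n - 1) * 2 ^ (3 * I.n + 2))

/-- This crude count keeps both the rounding loss and the number of wrap-arounds of a clique within
the range of the `n` slack weights of each kind. -/
theorem card_edges_filter_le (I : EEWInstance d) (S : Finset (Fin I.n)) :
    (I.edges.filter (· ⊆ S)).card ≤ 2 ^ I.n := by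
  refine (Finset.card_le_univ _).trans ?_
  rw [Fintype.card_finset, Fintype.card_fin]

theorem isYes_hashed (hd : 2 ≤ d) {I : EEWInstance d} (h : I.IsYes) (a c : ℕ) :
    (I.hashed a c).IsYes := by
  obtain ⟨S, hS, hw⟩ := h
  rw [weightOf_eq] at hw
  set E := I.edges.filter (· ⊆ S) with hE
  have hcard := I.card_edges_filter_le S
  set D := 2 ^ c with hD
  set Λ := 2 ^ (3 * I.n + 2) with hΛ
  have hM : 2 ^ (c + (3 * I.n + 2)) = D * Λ := pow_add _ _ _
  have hDpos : 0 < D := by positivity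
  have hΛpos : 0 < Λ := by positivity
  set M := D * Λ with hMdef
  have hMpos : 0 < M := by positivity
  set Q := ∑ e ∈ E, a * I.wt e % M with hQ
  have hQmod : Q % M = a * I.target % M := by
    rw [hQ, ← Finset.sum_nat_mod, ← Finset.mul_sum, hw]
  have hQlt : Q < 2 ^ I.n * M := by
    have h1 : Q ≤ E.card * (M - 1) := by
      rw [hQ, ← smul_eq_mul]
      exact Finset.sum_le_card_nsmul _ _ _ fun e _ => Nat.le_sub_one_of_lt (Nat.mod_lt _ hMpos)
    calc Q ≤ 2 ^ I.n * (M - 1) := h1.trans (Nat.mul_le_mul_right _ hcard)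
      _ < _ := Nat.mul_lt_mul_of_pos_left (by omega) (by positivity)
  -- `Q` is the sum of the residues and `W` the sum of their rounded values. Each rounding loses at
  -- most `D - 1`, so `Q / D` exceeds `W` by less than `2 ^ n`.
  set W := ∑ e ∈ E, a * I.wt e % M / D with hW
  have hWle : D * W ≤ Q := by
    rw [hW, Finset.mul_sum]
    exact Finset.sum_le_sum fun e _ => Nat.mul_div_le _ _
  have hQle : Q < D * (W + 2 ^ I.n) := by
    have h1 : Q ≤ ∑ e ∈ E, (D * (a * I.wt e % M / D) + (D - 1)) :=
      Finset.sum_le_sum fun e _ => by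
        have h2 := Nat.div_add_mod (a * I.wt e % M) D
        have h3 := Nat.mod_lt (a * I.wt e % M) hDpos
        omega
    rw [Finset.sum_add_distrib, ← Finset.mul_sum, Finset.sum_const, smul_eq_mul] at h1
    calc Q ≤ D * W + 2 ^ I.n * (D - 1) := h1.trans (Nat.add_le_add_left (Nat.mul_le_mul_right _ hcard) _)
      _ < D * W + 2 ^ I.n * D :=
        Nat.add_lt_add_left (Nat.mul_lt_mul_of_pos_left (by omega) (by positivity)) _
      _ = _ := by ring
  have hj : Q / M < 2 ^ I.n := Nat.div_lt_of_lt_mul (by rwa [mul_comm])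
  -- `Q` is congruent to `a * t` modulo `M = D * Λ`, so `Q / D` is the hash of the target plus `Q /
  -- M` wrap-arounds of `Λ`.
  have hQD : Q / D = a * I.target % M / D + Q / M * Λ := by
    conv_lhs => rw [← Nat.mod_add_div Q M, hQmod, hMdef, mul_assoc]
    rw [Nat.add_mul_div_left _ _ hDpos, mul_comm Λ]
  have hW1 : W ≤ Q / D := (Nat.le_div_iff_mul_le hDpos).mpr (by rwa [mul_comm])
  have hW2 : Q / D < W + 2 ^ I.n := Nat.div_lt_of_lt_mul hQle
  -- The low slack pays the rounding loss; the high slack raises the wrap-around count `Q / M` to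
  -- the fixed value `2 ^ n - 1` built into the target.
  refine isYes_reduce hd hS (r := Q / D - W) (k := 2 ^ I.n - 1 - Q / M) (by omega)
    ((Nat.sub_le _ _).trans_lt (by have := Nat.two_pow_pos I.n; omega)) ?_
  have hsum : ∑ e ∈ E, hashWeight I.n a c (I.wt e) = W := by
    simp only [hashWeight, hM, hW, hD]
  rw [hsum, hashWeight, hM, ← hD, ← hΛ]
  have h3 : (2 ^ I.n - 1) * Λ = (2 ^ I.n - 1 - Q / M) * Λ + Q / M * Λ := by
    rw [← add_mul]; congr 1; omega
  omega

/-- Scaling the weight equation by `2 ^ c` and restoring the remainders turns it into a congruence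
modulo `2 ^ R`, in which every multiple of the modulus vanishes. What is left of `a * (w(S) - t)` is
`ρ - r * D - ρ'`, which is confined to a short interval. -/
theorem exists_of_isYes_hashed (hd : 2 ≤ d) {I : EEWInstance d} {a c : ℕ}
    (h : (I.hashed a c).IsYes) : ∃ S, I.IsHyperclique S ∧
      ∃ i < 2 ^ (c + I.n + 2),
        (a : ZMod (2 ^ (c + (3 * I.n + 2)))) * (((I.weightOf S : ℤ) - I.target : ℤ) : ZMod _) =
          -((2 ^ I.n * 2 ^ c + 2 ^ c : ℕ) : ZMod (2 ^ (c + (3 * I.n + 2)))) +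
          ((i : ℕ) : ZMod (2 ^ (c + (3 * I.n + 2)))) := by
  obtain ⟨S, hS, r, hr, k, hk⟩ := exists_of_isYes_reduce hd h
  refine ⟨S, hS, ?_⟩
  rw [weightOf_eq]
  set E := I.edges.filter (· ⊆ S) with hE
  have hcard : E.card ≤ 2 ^ I.n := I.card_edges_filter_le S
  simp only [hashWeight] at hk
  set M := 2 ^ (c + (3 * I.n + 2)) with hM
  set Λ := 2 ^ (3 * I.n + 2) with hΛ
  set D := 2 ^ c with hD
  have hDpos : 0 < D := by positivity
  have hMD : D * Λ = M := (pow_add _ _ _).symm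
  set ρ := ∑ e ∈ E, a * I.wt e % M % D with hρ
  set ρ' := a * I.target % M % D with hρ'
  have hρle : ρ ≤ 2 ^ I.n * (D - 1) := by
    refine le_trans ?_ (Nat.mul_le_mul_right _ hcard)
    rw [← smul_eq_mul]
    exact Finset.sum_le_card_nsmul _ _ _ fun e _ => Nat.le_sub_one_of_lt (Nat.mod_lt _ hDpos)
  have hρlt : ρ < 2 ^ I.n * D :=
    hρle.trans_lt (Nat.mul_lt_mul_of_pos_left (by omega) (by positivity))
  have hρ'lt : ρ' < D := Nat.mod_lt _ hDpos
  have hrD : r * D ≤ 2 ^ I.n * D := Nat.mul_le_mul_right _ hr.le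
  have hone : D ≤ 2 ^ I.n * D := Nat.le_mul_of_pos_left _ (by positivity)
  -- The shift by `2 ^ n * D + D` makes every term nonnegative. The three terms are each at most `2
  -- ^ n * D`, so the sum stays below `4 * 2 ^ n * D`.
  refine ⟨ρ + (2 ^ I.n * D - r * D) + (D - ρ'), ?_, ?_⟩
  · have : 2 ^ (c + I.n + 2) = 4 * (2 ^ I.n * D) := by rw [pow_add, pow_add]; ring
    omega
  have hsum : (∑ e ∈ E, a * I.wt e % M) = D * (∑ e ∈ E, a * I.wt e % M / D) + ρ := by
    rw [Finset.mul_sum, hρ, ← Finset.sum_add_distrib]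
    exact Finset.sum_congr rfl fun e _ => (Nat.div_add_mod _ _).symm
  have htar : a * I.target % M = D * (a * I.target % M / D) + ρ' := (Nat.div_add_mod _ _).symm
  have hmain : (∑ e ∈ E, a * I.wt e % M) + r * D + ρ' + k * M =
      a * I.target % M + ρ + (2 ^ I.n - 1) * M := by
    have h1 := congrArg (D * ·) hk
    simp only [mul_add] at h1
    have h2 : k * M = D * (k * Λ) := by rw [← hMD]; ring
    have h3 : (2 ^ I.n - 1) * M = D * ((2 ^ I.n - 1) * Λ) := by rw [← hMD]; ring
    rw [h2, h3]
    linarith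
  have hcast := congrArg (Nat.cast : ℕ → ZMod M) hmain
  push_cast [ZMod.natCast_mod, ZMod.natCast_self] at hcast
  rw [← Finset.mul_sum] at hcast
  push_cast [Nat.cast_sub hrD, Nat.cast_sub hρ'lt.le]
  simp only [mul_zero, add_zero] at hcast
  linear_combination hcast

/-- With `q = c + n + 2` one has `R - q = 2n`: each clique is bad with probability at most `2 ^
(-2n)`, and there are at most `2 ^ n` cliques. -/
theorem fairCoins_isYes_hashed_le (hd : 2 ≤ d) {I : EEWInstance d} (hI : ¬ I.IsYes) {c : ℕ}
    (hc : ∀ S, ((I.weightOf S : ℤ) - I.target).natAbs ≤ 2 ^ c) :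
    RAM.fairCoins {ω | (I.hashed (RAM.coinNumber ω (c + (3 * I.n + 2))) c).IsYes} ≤
      (2⁻¹ : ENNReal) ^ I.n := by
  classical
  set R := c + (3 * I.n + 2) with hR
  let bad (S : Finset (Fin I.n)) : Set (ℕ → Bool) := {ω | ∃ i < 2 ^ (c + I.n + 2),
    (RAM.coinNumber ω R : ZMod (2 ^ R)) * (((I.weightOf S : ℤ) - I.target : ℤ) : ZMod _) =
      -((2 ^ I.n * 2 ^ c + 2 ^ c : ℕ) : ZMod (2 ^ (c + (3 * I.n + 2)))) +
          ((i : ℕ) : ZMod (2 ^ (c + (3 * I.n + 2))))}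
  have hsub : {ω | (I.hashed (RAM.coinNumber ω R) c).IsYes} ⊆
      ⋃ S ∈ Finset.univ.filter fun S => I.IsHyperclique S, bad S := by
    intro ω hω
    obtain ⟨S, hS, hi⟩ := exists_of_isYes_hashed hd hω
    exact Set.mem_biUnion (Finset.mem_coe.mpr (Finset.mem_filter.mpr ⟨Finset.mem_univ S, hS⟩)) hi
  have hbad : ∀ S ∈ Finset.univ.filter fun S => I.IsHyperclique S,
      RAM.fairCoins (bad S) ≤ 2 ^ (c + I.n + 2) * (2⁻¹ : ENNReal) ^ R := by
    intro S hS
    refine RAM.fairCoins_mul_mem_interval_le (R := R) (q := c + I.n + 2) (by omega) ?_ ?_ _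
    · intro h0
      exact hI ⟨S, (Finset.mem_filter.mp hS).2, by omega⟩
    · exact (hc S).trans (Nat.pow_le_pow_right (by norm_num) (by omega))
  calc _ ≤ _ := measure_mono hsub
    _ ≤ _ := measure_biUnion_finset_le _ _
    _ ≤ _ := Finset.sum_le_sum hbad
    _ ≤ 2 ^ I.n * (2 ^ (c + I.n + 2) * (2⁻¹ : ENNReal) ^ R) := by
        rw [Finset.sum_const, nsmul_eq_mul]
        gcongr
        have : (Finset.univ.filter fun S => I.IsHyperclique S).card ≤ 2 ^ I.n := by
          refine (Finset.card_le_univ _).trans ?_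
          rw [Fintype.card_finset, Fintype.card_fin]
        exact_mod_cast this
    _ = (2⁻¹ : ENNReal) ^ I.n := by
        rw [show R = (I.n + (c + I.n + 2)) + I.n by omega, pow_add _ _ I.n, ← mul_assoc,
          ← mul_assoc, ← pow_add, ← mul_pow, ENNReal.mul_inv_cancel (by norm_num) (by norm_num),
          one_pow, one_mul]

end EEWInstance

/-! ### The program and its loop invariants -/

namespace RAM

instance : Add Expr := ⟨.op .add⟩
instance : Sub Expr := ⟨.op .sub⟩
instance : Mul Expr := ⟨.op .mul⟩
instance : Div Expr := ⟨.op .div⟩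
instance : Mod Expr := ⟨.op .mod⟩

/-- The content of the cell with the fixed address `i`. -/
def reg (i : ℕ) : Expr := .cell (.lit i)

namespace Expr

variable (M : ℕ → ℕ) (a b : Expr)

@[simp] theorem eval_lit (c : ℕ) : (lit c).eval M = c := rfl
@[simp] theorem eval_cell : (cell a).eval M = M (a.eval M) := rfl
@[simp] theorem eval_reg (i : ℕ) : (reg i).eval M = M i := rfl
@[simp] theorem eval_add : (a + b).eval M = a.eval M + b.eval M := rfl
@[simp] theorem eval_sub : (a - b).eval M = a.eval M - b.eval M := rfl
@[simp] theorem eval_mul : (a * b).eval M = a.eval M * b.eval M := rfl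
@[simp] theorem eval_div : (a / b).eval M = a.eval M / b.eval M := rfl
@[simp] theorem eval_mod : (a % b).eval M = a.eval M % b.eval M := rfl

/-- The sum of `f 0, …, f (n - 1)`. -/
def sum (f : ℕ → Expr) : ℕ → Expr
  | 0 => .lit 0
  | n + 1 => sum f n + f n

/-- The product of `f 0, …, f (n - 1)`. -/
def prod (f : ℕ → Expr) : ℕ → Expr
  | 0 => .lit 1
  | n + 1 => prod f n * f n

/-- The power of an expression with a fixed exponent. -/
def pow (e : Expr) (n : ℕ) : Expr := prod (fun _ => e) n

@[simp] theorem eval_sum (f : ℕ → Expr) (n : ℕ) :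
    (sum f n).eval M = ∑ i ∈ Finset.range n, (f i).eval M := by
  induction n with
  | zero => rfl
  | succ n ih => rw [sum, eval_add, ih, Finset.sum_range_succ]

@[simp] theorem eval_prod (f : ℕ → Expr) (n : ℕ) :
    (prod f n).eval M = ∏ i ∈ Finset.range n, (f i).eval M := by
  induction n with
  | zero => rfl
  | succ n ih => rw [prod, eval_mul, ih, Finset.prod_range_succ]

@[simp] theorem eval_pow (n : ℕ) : (a.pow n).eval M = a.eval M ^ n := by
  simp [pow]

end Expr

open RAM.Expr

@[simp] theorem run_assign (ω : ℕ → Bool) (a e : Expr) (s : State) : (Prog.assign a e).run ω s =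
    { s with mem := Function.update s.mem (a.eval s.mem) (e.eval s.mem) } := rfl
@[simp] theorem run_read (ω : ℕ → Bool) (a : Expr) (s : State) : (Prog.read a).run ω s =
    { s with
      mem := Function.update s.mem (a.eval s.mem) (s.input.headD 0), input := s.input.tail } := rfl
@[simp] theorem run_toss (ω : ℕ → Bool) (a : Expr) (s : State) : (Prog.toss a).run ω s =
    { s with
      mem := Function.update s.mem (a.eval s.mem) (ω s.tossed).toNat, tossed := s.tossed + 1 } := rfl
@[simp] theorem run_write (ω : ℕ → Bool) (e : Expr) (s : State) : (Prog.write e).run ω s =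
    { s with output := s.output ++ [e.eval s.mem] } := rfl
@[simp] theorem run_seq (ω : ℕ → Bool) (p q : Prog) (s : State) :
    (Prog.seq p q).run ω s = q.run ω (p.run ω s) := rfl
@[simp] theorem run_ite (ω : ℕ → Bool) (e : Expr) (p q : Prog) (s : State) :
    (Prog.ite e p q).run ω s = if e.eval s.mem ≠ 0 then p.run ω s else q.run ω s := rfl

theorem update_lt {m : ℕ → ℕ} {b : ℕ} (h : ∀ a, m a < b) (a : ℕ) {x : ℕ} (hx : x < b) (a' : ℕ) :
    Function.update m a x a' < b := by
  by_cases ha : a' = a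
  · subst ha; simpa using hx
  · simpa [ha] using h a'

/-- The condition of the loops that count in cell `2` up to the content of cell `9`. -/
def countCond : Expr := reg 9 - reg 2

/-- Memory layout: cells `0`, `1`, `7` hold `n`, `t` and the new number `N` of vertices; `2` and `9`
are a counter and its limit; `3` accumulates `t + 1` plus all array entries; `4` is the current
slack weight; `5` and `6` are `2 ^ i` and the number formed by the first `i` coins; `8` limits the
tossing, `10` is the last coin, `11` is `2 ^ c` and `12` is `2 ^ (3n + 2)`. The vertex weights start
at cell `16`, the input array at cell `16 + N`. -/
def setup (d : ℕ) : Prog :=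
  .seq (.read (.lit 0)) <| .seq (.read (.lit 1)) <|
  .seq (.assign (.lit 7) (reg 0 + (.lit (d - 1) + .lit 2 * reg 0))) <|
  .seq (.assign (.lit 3) (reg 1 + .lit 1)) <| .assign (.lit 9) ((reg 0).pow d)

def readBody : Prog :=
  .seq (.read (reg 7 + reg 2 + .lit 16)) <|
  .seq (.assign (.lit 3) (reg 3 + .cell (reg 7 + reg 2 + .lit 16))) <|
  .assign (.lit 2) (reg 2 + .lit 1)

def startTable : Prog :=
  .seq (.assign (.lit 2) (.lit 0)) <| .seq (.assign (.lit 4) (.lit 1)) <|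
  .assign (.lit 9) (.lit 2 * reg 0)

/-- The slack weight doubles except when the counter reaches `n`: there `32 * (2 ^ (n - 1)) ^ 3 = 2
^ (3n + 2)` starts the high block. -/
def tableBody (d : ℕ) : Prog :=
  .seq (.assign (reg 0 + .lit (d - 1) + reg 2 + .lit 16) (reg 4)) <|
  .seq (.assign (.lit 2) (reg 2 + .lit 1)) <|
  .ite ((reg 0 - reg 2) + (reg 2 - reg 0)) (.assign (.lit 4) (.lit 2 * reg 4))
    (.assign (.lit 4) (.lit 32 * (reg 4 * reg 4 * reg 4)))

def startCoins (d : ℕ) : Prog :=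
  .seq (.assign (.lit 12) (.cell (reg 0 + .lit (d - 1) + reg 0 + .lit 16))) <|
  .seq (.assign (.lit 8) (reg 3 * reg 12 + .lit 1)) <| .assign (.lit 5) (.lit 1)

/-- Cell `8` is one more than `(t + 1 + ∑ entries) * 2 ^ (3n + 2)`, so tossing stops at the first
power of two exceeding that product. The number `R` of coins is thus its bit length. -/
def coinCond : Expr := reg 8 - reg 5

def coinBody : Prog :=
  .seq (.assign (.lit 5) (.lit 2 * reg 5)) <| .seq (.toss (.lit 10)) <|
  .assign (.lit 6) (.lit 2 * reg 6 + reg 10)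

/-- The table loop leaves `2 ^ n * 2 ^ (3n + 2)` in cell `4`; subtracting cell `12` gives the
constant part of the new target. -/
def startOutput (d : ℕ) : Prog :=
  .seq (.assign (.lit 11) (reg 5 / reg 12)) <| .seq (.write (reg 7)) <|
  .seq (.write (reg 6 * reg 1 % reg 5 / reg 11 + (reg 4 - reg 12))) <|
  .seq (.assign (.lit 2) (.lit 0)) <| .assign (.lit 9) ((reg 7).pow d)

/-- The base-`N` digits of the counter. -/
def digit (i : ℕ) : Expr := reg 2 / (reg 7).pow i % reg 7

/-- Truncated subtraction serves as comparison: a summand is positive exactly when its digit is at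
least `n`. -/
def hasNew (d : ℕ) : Expr := .sum (fun i => digit i + .lit 1 - reg 0) d

def distinct (d : ℕ) : Expr :=
  .prod (fun i => .prod (fun j => (digit i - digit j) + (digit j - digit i)) i) d

/-- The two factors are the indicators of `n ≤ digit` and `digit < n + (d - 1)`. -/
def coreCount (d : ℕ) : Expr :=
  .sum (fun i => (.lit 1 - (reg 0 - digit i)) *
    (.lit 1 - (digit i + .lit 1 - (reg 0 + .lit (d - 1))))) d

def tableSum (d : ℕ) : Expr := .sum (fun i => .cell (digit i + .lit 16)) d

/-- Meaningful only when all digits are below `n`: they are then reread in base `n` as a position of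
the input array. -/
def oldEntry (d : ℕ) : Expr :=
  .cell (reg 7 + .sum (fun i => digit i * (reg 0).pow i) d + .lit 16)

def outputBody (d : ℕ) : Prog :=
  .seq (.ite (hasNew d)
    (.ite (distinct d)
      (.ite (.lit (d - 1) - coreCount d) (.write (.lit 1)) (.write (tableSum d + .lit 1)))
      (.write (.lit 0)))
    (.ite (oldEntry d)
      (.write (reg 6 * (oldEntry d - .lit 1) % reg 5 / reg 11 + .lit 1)) (.write (.lit 0)))) <|
  .assign (.lit 2) (reg 2 + .lit 1)

/-- The reduction as a program. -/
def reduction (d : ℕ) : Prog :=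
  .seq (setup d) <| .seq (.loop countCond readBody) <|
  .seq startTable <| .seq (.loop countCond (tableBody d)) <|
  .seq (startCoins d) <| .seq (.loop coinCond coinBody) <|
  .seq (startOutput d) <| .loop countCond (outputBody d)

open EEWInstance

/-- Facts about the memory that hold from the end of the setup. -/
structure Basic (d n t Z : ℕ) (s : State) : Prop where
  mem_zero : s.mem 0 = n
  mem_one : s.mem 1 = t
  mem_seven : s.mem 7 = reducedSize d n
  lt : ∀ a, s.mem a < 2 ^ Z

/-- The zero entries are carried along because later phases rely on cells never written: the table
values of old and core vertices, and the initial coin number. -/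
structure ReadInv (d n t Z : ℕ) (l : List ℕ) (i : ℕ) (s : State) : Prop
    extends Basic d n t Z s where
  mem_two : s.mem 2 = i
  mem_three : s.mem 3 = t + 1 + (l.take i).sum
  mem_six : s.mem 6 = 0
  mem_nine : s.mem 9 = l.length
  array : ∀ k < i, s.mem (reducedSize d n + k + 16) = l.getD k 0
  table : ∀ v < reducedSize d n, s.mem (v + 16) = 0
  input : s.input = l.drop i
  output : s.output = []
  tossed : s.tossed = 0

structure TableInv (d n t Z : ℕ) (l : List ℕ) (i : ℕ) (s : State) : Prop
    extends Basic d n t Z s where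
  mem_two : s.mem 2 = i
  mem_three : s.mem 3 = t + 1 + l.sum
  mem_four : s.mem 4 = slackWeight n i
  mem_six : s.mem 6 = 0
  mem_nine : s.mem 9 = 2 * n
  array : ∀ k < l.length, s.mem (reducedSize d n + k + 16) = l.getD k 0
  table : ∀ v < reducedSize d n,
    s.mem (v + 16) = if v < n + (d - 1) + i then vertexWeight d n v else 0
  input : s.input = []
  output : s.output = []
  tossed : s.tossed = 0

structure Loaded (d n t Z : ℕ) (l : List ℕ) (s : State) : Prop
    extends Basic d n t Z s where
  array : ∀ k < l.length, s.mem (reducedSize d n + k + 16) = l.getD k 0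
  table : ∀ v < reducedSize d n, s.mem (v + 16) = vertexWeight d n v
  input : s.input = []

structure CoinInv (d n t Z : ℕ) (l : List ℕ) (ω : ℕ → Bool) (i : ℕ) (s : State) : Prop
    extends Loaded d n t Z l s where
  mem_four : s.mem 4 = 2 ^ n * 2 ^ (3 * n + 2)
  mem_five : s.mem 5 = 2 ^ i
  mem_six : s.mem 6 = coinNumber ω i
  mem_eight : s.mem 8 = (t + 1 + l.sum) * 2 ^ (3 * n + 2) + 1
  mem_twelve : s.mem 12 = 2 ^ (3 * n + 2)
  output : s.output = []
  tossed : s.tossed = i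

/-- The number written for the position `k` of the new adjacency array. -/
def outputEntry (d n M D a : ℕ) (l : List ℕ) (k : ℕ) : ℕ :=
  let N := reducedSize d n
  let v (i : ℕ) : ℕ := k / N ^ i % N
  let w : ℕ := l.getD (∑ i ∈ Finset.range d, v i * n ^ i) 0
  if ∑ i ∈ Finset.range d, (v i + 1 - n) ≠ 0 then
    if ∏ i ∈ Finset.range d, ∏ j ∈ Finset.range i, ((v i - v j) + (v j - v i)) ≠ 0 then
      if d - 1 - ∑ i ∈ Finset.range d, (1 - (n - v i)) * (1 - (v i + 1 - (n + (d - 1)))) ≠ 0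
        then 1 else ∑ i ∈ Finset.range d, vertexWeight d n (v i) + 1
    else 0
  else if w ≠ 0 then a * (w - 1) % M / D + 1 else 0

structure OutputInv (d n t Z : ℕ) (l : List ℕ) (M D a τ : ℕ) (i : ℕ) (s : State) : Prop
    extends Loaded d n t Z l s where
  mem_two : s.mem 2 = i
  mem_five : s.mem 5 = M
  mem_six : s.mem 6 = a
  mem_nine : s.mem 9 = reducedSize d n ^ d
  mem_eleven : s.mem 11 = D
  output : s.output = reducedSize d n :: τ :: (List.range i).map (outputEntry d n M D a l)

theorem Basic.bdd {d n t Z : ℕ} {s : State} (h : Basic d n t Z s)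
    (hin : ∀ x ∈ s.input, x < 2 ^ Z) : s.Bdd Z :=
  ⟨fun a => Nat.size_le.mpr (h.lt a), fun x hx => Nat.size_le.mpr (hin x hx)⟩

section

variable {d n t Z : ℕ} {l : List ℕ}

theorem readInv_setup (ω : ℕ → Bool) (hn : n < 2 ^ Z) (ht : t + 1 < 2 ^ Z)
    (hl : l.length = n ^ d) (hN : reducedSize d n < 2 ^ Z) (hlZ : l.length < 2 ^ Z) :
    ReadInv d n t Z l 0 ((setup d).run ω (init (n :: t :: l))) := by
  have hrun : (setup d).run ω (init (n :: t :: l)) =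
      ⟨Function.update (Function.update (Function.update (Function.update (Function.update
        (fun _ => 0) 0 n) 1 t) 7 (reducedSize d n)) 3 (t + 1)) 9 l.length, l, [], 0⟩ := by
    simp [setup, init, hl]
  rw [hrun]
  constructor
  case toBasic =>
    constructor
    case lt => exact update_lt (update_lt (update_lt (update_lt (update_lt (by simp) _ hn) _
      (by omega)) _ hN) _ ht) _ hlZ
    all_goals simp
  all_goals simp

theorem ReadInv.step (ω : ℕ → Bool) {i : ℕ} {s : State} (h : ReadInv d n t Z l i s)
    (hi : i < l.length) (hlZ : l.length < 2 ^ Z) (hA : t + 1 + l.sum < 2 ^ Z) :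
    ReadInv d n t Z l (i + 1) (readBody.run ω s) := by
  have hhead : s.input.headD 0 = l[i] := by
    rw [h.input, List.drop_eq_getElem_cons hi]; rfl
  have hsum : (l.take (i + 1)).sum = (l.take i).sum + l[i] := by
    exact List.sum_take_succ l i hi
  have hle : (l.take (i + 1)).sum ≤ l.sum := by
    conv_rhs => rw [← List.take_append_drop (i + 1) l, List.sum_append]
    omega
  have hthree : s.mem 3 + l[i] = t + 1 + (l.take (i + 1)).sum := by
    rw [h.mem_three, hsum, add_assoc]
  have htail : s.input.tail = l.drop (i + 1) := by rw [h.input, List.tail_drop]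
  have hrun : readBody.run ω s =
      ⟨Function.update (Function.update (Function.update s.mem (reducedSize d n + i + 16) l[i])
        3 (t + 1 + (l.take (i + 1)).sum)) 2 (i + 1), l.drop (i + 1), [], 0⟩ := by
    generalize l[i] = x at hhead hthree
    simp [readBody, hhead, h.mem_two, h.mem_seven, htail, h.output, h.tossed, ← hthree,
      -List.headD_eq_head?_getD, Function.update_apply]
  rw [hrun]
  have h0 := h.toBasic
  constructor
  case toBasic =>
    constructor
    case lt => exact update_lt (update_lt (update_lt h.lt _ (by omega)) _ (by omega)) _ (by omega)
    all_goals simp [h0.mem_zero, h0.mem_one, h0.mem_seven]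
  case array =>
    intro k hk
    rcases Nat.lt_succ_iff_lt_or_eq.mp hk with hk | rfl
    · simp [h.array k hk, hk.ne]
    · simp [hi]
  case table =>
    intro v hv
    have : v ≠ reducedSize d n + i := by omega
    simp [h.table v hv, this]
  all_goals simp [h.mem_six, h.mem_nine]

theorem ReadInv.startTable (ω : ℕ → Bool) {s : State} (h : ReadInv d n t Z l l.length s)
    (hn : 0 < n) (hnZ : 2 * n < 2 ^ Z) : TableInv d n t Z l 0 (startTable.run ω s) := by
  have hrun : RAM.startTable.run ω s =
      ⟨Function.update (Function.update (Function.update s.mem 2 0) 4 1) 9 (2 * n), [], [], 0⟩ := by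
    simp [RAM.startTable, h.mem_zero, h.input, h.output, h.tossed]
  rw [hrun]
  have h0 := h.toBasic
  constructor
  case toBasic =>
    constructor
    case lt => exact update_lt (update_lt (update_lt h.lt _ (by omega)) _ (by omega)) _ (by omega)
    all_goals simp [h0.mem_zero, h0.mem_one, h0.mem_seven]
  case array =>
    intro k hk
    simpa [Function.update_apply] using h.array k hk
  case table =>
    intro v hv
    have : v < n + (d - 1) → vertexWeight d n v = 0 := fun hv => by rw [vertexWeight, if_pos hv]
    simp +contextual [h.table v hv, this]
  case mem_four => simp [slackWeight, hn]
  case mem_three => simp [h.mem_three]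
  all_goals simp [h.mem_six]

theorem TableInv.step (ω : ℕ → Bool) {i : ℕ} {s : State} (h : TableInv d n t Z l i s)
    (hi : i < 2 * n) (hnZ : 4 * n + 2 < Z) : TableInv d n t Z l (i + 1) ((tableBody d).run ω s) := by
  have hX : (if n - (i + 1) + (i + 1 - n) ≠ 0 then 2 * slackWeight n i else
      32 * (slackWeight n i * slackWeight n i * slackWeight n i)) = slackWeight n (i + 1) := by
    split_ifs with hc
    · by_cases hin : i + 1 < n
      · rw [slackWeight, slackWeight, if_pos hin, if_pos (by omega), pow_succ, mul_comm]
      · rw [slackWeight, slackWeight, if_neg hin, if_neg (by omega), ← pow_succ']; rfl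
    · obtain rfl : n = i + 1 := by omega
      rw [slackWeight, slackWeight, if_pos (by omega), if_neg (by omega), ← pow_add, ← pow_add,
        show (32 : ℕ) = 2 ^ 5 by norm_num, ← pow_add]
      congr 1; omega
  have hrun : (tableBody d).run ω s =
      ⟨Function.update (Function.update (Function.update s.mem (n + (d - 1) + i + 16)
        (slackWeight n i)) 2 (i + 1)) 4 (slackWeight n (i + 1)), [], [], 0⟩ := by
    rw [← hX]
    simp only [tableBody, run_seq, run_assign, run_ite]
    split_ifs with h1 h2 h2 <;>
    simp [h.mem_zero, h.mem_two, h.mem_four, h.input, h.output, h.tossed] at h1 h2 ⊢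
    · omega
    · omega
  rw [hrun]
  have hlt : ∀ j ≤ 2 * n, slackWeight n j < 2 ^ Z := by
    intro j hj
    rw [slackWeight]
    split_ifs <;> exact Nat.pow_lt_pow_right (by norm_num) (by omega)
  have hZ : Z < 2 ^ Z := Nat.lt_two_pow_self
  have h0 := h.toBasic
  constructor
  case toBasic =>
    constructor
    case lt => exact update_lt (update_lt (update_lt h.lt _ (hlt i hi.le)) _ (by omega)) _
                (hlt (i + 1) hi)
    all_goals simp [h0.mem_zero, h0.mem_one, h0.mem_seven]
  case array =>
    intro k hk
    have : reducedSize d n + k ≠ n + (d - 1) + i := by simp only [reducedSize]; omega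
    simpa [Function.update_apply, this] using h.array k hk
  case table =>
    intro v hv
    by_cases hvi : v = n + (d - 1) + i
    · subst hvi
      simp [vertexWeight_add]
    · have : v < n + (d - 1) + (i + 1) ↔ v < n + (d - 1) + i := by omega
      simp [h.table v hv, this, hvi]
  case mem_three => simp [h.mem_three]
  all_goals simp [h.mem_six, h.mem_nine]

theorem TableInv.startCoins (ω : ℕ → Bool) {s : State} (h : TableInv d n t Z l (2 * n) s)
    (hn : 0 < n) (hnZ : (t + 1 + l.sum) * 2 ^ (3 * n + 2) + 1 < 2 ^ Z) :
    CoinInv d n t Z l ω 0 ((startCoins d).run ω s) := by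
  -- Slack index `n` is the first high weight, which is `2 ^ (3 * n + 2)` itself.
  have hΛ : s.mem (n + (d - 1) + n + 16) = 2 ^ (3 * n + 2) := by
    rw [h.table _ (by simp only [reducedSize]; omega), if_pos (by omega), vertexWeight_add]
    simpa using slackWeight_add n 0
  have hrun : (RAM.startCoins d).run ω s =
      ⟨Function.update (Function.update (Function.update s.mem 12 (2 ^ (3 * n + 2))) 8
        ((t + 1 + l.sum) * 2 ^ (3 * n + 2) + 1)) 5 1, [], [], 0⟩ := by
    simp [RAM.startCoins, h.mem_zero, hΛ, h.mem_three, h.input, h.output, h.tossed]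
  rw [hrun]
  have hlt : 2 ^ (3 * n + 2) < 2 ^ Z := by
    refine lt_of_le_of_lt ?_ hnZ
    nlinarith [Nat.two_pow_pos (3 * n + 2), Nat.zero_le ((t + l.sum) * 2 ^ (3 * n + 2))]
  have h0 := h.toBasic
  constructor
  case toLoaded =>
    constructor
    case toBasic =>
      constructor
      case lt => exact update_lt (update_lt (update_lt h.lt _ hlt) _ hnZ) _ (by omega)
      all_goals simp [h0.mem_zero, h0.mem_one, h0.mem_seven]
    case array =>
      intro k hk
      simpa [Function.update_apply] using h.array k hk
    case table =>
      intro v hv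
      have : v < n + (d - 1) + 2 * n := by simp only [reducedSize] at hv; omega
      simp [h.table v hv, this]
    case input => rfl
  case mem_four =>
    have := slackWeight_add n n
    rw [← two_mul] at this
    simp only [ne_eq, Nat.reduceEqDiff, not_false_eq_true,
      Function.update_of_ne]
    rw [h.mem_four, this, mul_comm]
  all_goals simp [h.mem_six, coinNumber]

theorem CoinInv.step (ω : ℕ → Bool) {i : ℕ} {s : State} (h : CoinInv d n t Z l ω i s)
    (hi : i + 1 < Z) : CoinInv d n t Z l ω (i + 1) (coinBody.run ω s) := by
  have hrun : coinBody.run ω s =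
      ⟨Function.update (Function.update (Function.update s.mem 5 (2 ^ (i + 1))) 10 (ω i).toNat) 6
        (coinNumber ω (i + 1)), [], [], i + 1⟩ := by
    simp [coinBody, h.mem_five, h.mem_six, h.input, h.output, h.tossed, coinNumber, pow_succ']
  rw [hrun]
  have hlt : 2 ^ (i + 1) < 2 ^ Z := Nat.pow_lt_pow_right (by norm_num) hi
  have hlt' := (coinNumber_lt ω (i + 1)).trans hlt
  have htoss := Bool.toNat_le (ω i)
  have hpos : 1 < 2 ^ (i + 1) := Nat.one_lt_two_pow (by omega)
  have h0 := h.toBasic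
  constructor
  case toLoaded =>
    constructor
    case toBasic =>
      constructor
      case lt => exact update_lt (update_lt (update_lt h.lt _ hlt) _ (by omega)) _ hlt'
      all_goals simp [h0.mem_zero, h0.mem_one, h0.mem_seven]
    case array =>
      intro k hk
      simpa [Function.update_apply] using h.array k hk
    case table =>
      intro v hv
      simpa [Function.update_apply] using h.table v hv
    case input => rfl
  all_goals simp [h.mem_four, h.mem_eight, h.mem_twelve]

theorem CoinInv.startOutput (ω : ℕ → Bool) {R : ℕ} {s : State} (h : CoinInv d n t Z l ω R s)
    (hRZ : R < Z) (hN : reducedSize d n ^ d < 2 ^ Z) :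
    OutputInv d n t Z l (2 ^ R) (2 ^ R / 2 ^ (3 * n + 2)) (coinNumber ω R)
      (coinNumber ω R * t % 2 ^ R / (2 ^ R / 2 ^ (3 * n + 2)) + (2 ^ n - 1) * 2 ^ (3 * n + 2)) 0
      ((startOutput d).run ω s) := by
  have hrun : (RAM.startOutput d).run ω s =
      ⟨Function.update (Function.update (Function.update s.mem 11 (2 ^ R / 2 ^ (3 * n + 2))) 2 0) 9
        (reducedSize d n ^ d), [], [reducedSize d n,
          coinNumber ω R * t % 2 ^ R / (2 ^ R / 2 ^ (3 * n + 2)) +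
            (2 ^ n - 1) * 2 ^ (3 * n + 2)], R⟩ := by
    simp [RAM.startOutput, h.mem_four, h.mem_five, h.mem_six, h.mem_twelve, h.mem_one, h.mem_seven,
      h.input, h.output, h.tossed, Nat.sub_mul]
  rw [hrun]
  have hlt : 2 ^ R / 2 ^ (3 * n + 2) < 2 ^ Z :=
    (Nat.div_le_self _ _).trans_lt (Nat.pow_lt_pow_right (by norm_num) hRZ)
  have h0 := h.toBasic
  constructor
  case toLoaded =>
    constructor
    case toBasic =>
      constructor
      case lt => exact update_lt (update_lt (update_lt h.lt _ hlt) _ (by positivity)) _ hN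
      all_goals simp [h0.mem_zero, h0.mem_one, h0.mem_seven]
    case array =>
      intro k hk
      simpa [Function.update_apply] using h.array k hk
    case table =>
      intro v hv
      simpa [Function.update_apply] using h.table v hv
    case input => rfl
  all_goals simp [h.mem_five, h.mem_six]

theorem eval_digit (M : ℕ → ℕ) (i : ℕ) : (digit i).eval M = M 2 / M 7 ^ i % M 7 := by
  simp [digit]

theorem sum_mul_pow_lt {v : ℕ → ℕ} (hv : ∀ i < d, v i < n) :
    ∑ i ∈ Finset.range d, v i * n ^ i < n ^ d := by
  induction d with
  | zero => simp
  | succ d ih =>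
    rw [Finset.sum_range_succ, pow_succ]
    have h1 := ih fun i hi => hv i (by omega)
    have h2 := hv d (by omega)
    calc _ < n ^ d + v d * n ^ d := by omega
      _ = n ^ d * (v d + 1) := by ring
      _ ≤ _ := Nat.mul_le_mul_left _ h2

theorem OutputInv.step (ω : ℕ → Bool) {M D a τ i : ℕ} {s : State}
    (h : OutputInv d n t Z l M D a τ i s) (hl : l.length = n ^ d) (hn : 0 < n)
    (hi : i < reducedSize d n ^ d) (hN : reducedSize d n ^ d < 2 ^ Z) :
    OutputInv d n t Z l M D a τ (i + 1) ((outputBody d).run ω s) := by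
  have hNpos : 0 < reducedSize d n := by simp only [reducedSize]; omega
  have hdig : ∀ j, (digit j).eval s.mem = i / reducedSize d n ^ j % reducedSize d n := fun j => by
    rw [eval_digit, h.mem_two, h.mem_seven]
  have hdlt : ∀ j, i / reducedSize d n ^ j % reducedSize d n < reducedSize d n :=
    fun j => Nat.mod_lt _ hNpos
  have hnew : (hasNew d).eval s.mem = ∑ j ∈ Finset.range d,
      (i / reducedSize d n ^ j % reducedSize d n + 1 - n) := by
    simp [hasNew, hdig, h.mem_zero]
  have hdis : (distinct d).eval s.mem = ∏ j ∈ Finset.range d, ∏ k ∈ Finset.range j,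
      ((i / reducedSize d n ^ j % reducedSize d n - i / reducedSize d n ^ k % reducedSize d n) +
      (i / reducedSize d n ^ k % reducedSize d n - i / reducedSize d n ^ j % reducedSize d n)) := by
    simp [distinct, hdig]
  have hcore : (coreCount d).eval s.mem = ∑ j ∈ Finset.range d,
      (1 - (n - i / reducedSize d n ^ j % reducedSize d n)) *
      (1 - (i / reducedSize d n ^ j % reducedSize d n + 1 - (n + (d - 1)))) := by
    simp [coreCount, hdig, h.mem_zero]
  have htab : (tableSum d).eval s.mem = ∑ j ∈ Finset.range d,
      vertexWeight d n (i / reducedSize d n ^ j % reducedSize d n) := by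
    simp only [tableSum, eval_sum, eval_cell, eval_add, hdig, eval_lit]
    exact Finset.sum_congr rfl fun j _ => h.table _ (hdlt j)
  have hold : (hasNew d).eval s.mem = 0 → (oldEntry d).eval s.mem =
      l.getD (∑ j ∈ Finset.range d, i / reducedSize d n ^ j % reducedSize d n * n ^ j) 0 := by
    intro h0
    rw [hnew, Finset.sum_eq_zero_iff] at h0
    have hlt := sum_mul_pow_lt (d := d) (n := n)
      (v := fun j => i / reducedSize d n ^ j % reducedSize d n)
      (fun j hj => by have := h0 j (Finset.mem_range.mpr hj); omega)
    simp only [oldEntry, eval_cell, eval_add, eval_sum, eval_mul, hdig, eval_pow, eval_reg,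
      h.mem_zero, h.mem_seven, eval_lit]
    exact h.array _ (by rw [hl]; exact hlt)
  have hrun : (outputBody d).run ω s =
      ⟨Function.update s.mem 2 (i + 1), [], s.output ++ [outputEntry d n M D a l i], s.tossed⟩ := by
    simp only [outputBody, run_seq, run_ite, run_write, run_assign, outputEntry, ← hnew, ← hdis,
      ← hcore, ← htab]
    by_cases h1 : (hasNew d).eval s.mem ≠ 0
    · simp only [if_pos h1]
      by_cases h2 : (distinct d).eval s.mem ≠ 0
      · simp only [if_pos h2]
        have heq : (.lit (d - 1) - coreCount d : Expr).eval s.mem =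
          d - 1 - (coreCount d).eval s.mem := rfl
        by_cases h3 : d - 1 - (coreCount d).eval s.mem ≠ 0
        · simp only [if_pos h3, if_pos (heq ▸ h3)]; simp [h.mem_two, h.input]
        · simp only [if_neg h3, if_neg (heq ▸ h3)]; simp [h.mem_two, h.input]
      · simp only [if_neg h2]; simp [h.mem_two, h.input]
    · have h2 := hold (not_not.mp h1)
      simp only [if_neg h1, ← h2]
      split_ifs <;> simp [h.mem_two, h.mem_five, h.mem_six, h.mem_eleven, h.input]
  rw [hrun]
  have h0 := h.toBasic
  constructor
  case toLoaded =>
    constructor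
    case toBasic =>
      constructor
      case lt => exact update_lt h.lt _ (by omega)
      all_goals simp [h0.mem_zero, h0.mem_one, h0.mem_seven]
    case array =>
      intro k hk
      simpa [Function.update_apply] using h.array k hk
    case table =>
      intro v hv
      simpa [Function.update_apply] using h.table v hv
    case input => rfl
  case output => simp [h.output, List.range_succ]
  all_goals simp [h.mem_five, h.mem_six, h.mem_nine, h.mem_eleven]

end

end RAM

/-! ### Agreement of the program's output with the encoding -/

namespace EEWInstance

variable {d : ℕ}

/-- The adjacency array of an instance. -/
def array (I : EEWInstance d) : List ℕ :=
  List.ofFn fun k : Fin (I.n ^ d) => I.entry (finFunctionFinEquiv.symm k)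

theorem getD_array (I : EEWInstance d) (v : Fin d → Fin I.n) :
    I.array.getD (∑ i, (v i).val * I.n ^ i.val) 0 = I.entry v := by
  have h : ∑ i, (v i).val * I.n ^ i.val = (finFunctionFinEquiv v).val := rfl
  rw [h, array, List.getD_eq_getElem _ _ (by rw [List.length_ofFn]; exact Fin.is_lt _),
    List.getElem_ofFn, Fin.eta, Equiv.symm_apply_apply]

theorem prod_dist_ne_zero_iff {N : ℕ} {v : ℕ → ℕ} {f : Fin d → Fin N}
    (h : ∀ i : Fin d, v i = (f i).val) :
    ∏ i ∈ Finset.range d, ∏ j ∈ Finset.range i, ((v i - v j) + (v j - v i)) ≠ 0 ↔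
      Function.Injective f := by
  simp only [ne_eq, Finset.prod_eq_zero_iff, Finset.mem_range, not_exists, not_and]
  constructor
  · intro H
    have key : ∀ i j : Fin d, j < i → f i ≠ f j := by
      intro i j hji he
      have he := congrArg Fin.val he
      rw [← h, ← h] at he
      exact H i i.2 j hji (by omega)
    intro i j hij
    rcases lt_trichotomy i j with hlt | rfl | hlt
    · exact absurd hij.symm (key j i hlt)
    · rfl
    · exact absurd hij (key i j hlt)
  · intro H i hi j hj h0
    have := @H ⟨i, hi⟩ ⟨j, hj.trans hi⟩ (Fin.ext (by rw [← h, ← h]; simp only; omega))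
    exact absurd (congrArg Fin.val this) (by simp only; omega)

theorem card_inter_core_eq_sum {n : ℕ} {v : Fin d → Fin (reducedSize d n)}
    (hv : Function.Injective v) : (core d n ∩ Finset.univ.image v).card =
      ∑ i, (1 - (n - (v i).val)) * (1 - ((v i).val + 1 - (n + (d - 1)))) := by
  have h1 : ∀ i, (1 - (n - (v i).val)) * (1 - ((v i).val + 1 - (n + (d - 1)))) =
      if v i ∈ core d n then 1 else 0 := by
    intro i
    simp only [core, Finset.mem_filter, Finset.mem_univ, true_and]
    split_ifs with h
    · rw [show n - (v i).val = 0 by omega, show (v i).val + 1 - (n + (d - 1)) = 0 by omega]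
    · by_cases h2 : n ≤ (v i).val
      · rw [show 1 - ((v i).val + 1 - (n + (d - 1))) = 0 by omega, mul_zero]
      · rw [show 1 - (n - (v i).val) = 0 by omega, zero_mul]
  simp only [h1]
  rw [Finset.inter_comm, ← Finset.filter_mem_eq_inter, Finset.card_filter,
    Finset.sum_image fun i _ j _ hij => hv hij]

/-- For distinct digits, `coreCount` counts the core vertices hit; the core has `d - 1` elements, so
the truncated difference vanishes exactly when all are hit. -/
theorem core_subset_iff {n : ℕ} {v : Fin d → Fin (reducedSize d n)}
    (hv : Function.Injective v) : core d n ⊆ Finset.univ.image v ↔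
      ¬ d - 1 - ∑ i, (1 - (n - (v i).val)) * (1 - ((v i).val + 1 - (n + (d - 1)))) ≠ 0 := by
  rw [← card_inter_core_eq_sum hv]
  constructor
  · intro h
    rw [Finset.inter_eq_left.mpr h, card_core]; simp
  · intro h
    rw [← Finset.inter_eq_left]
    refine Finset.eq_of_subset_of_card_le Finset.inter_subset_left ?_
    rw [card_core]; omega

/-- A tuple with a new vertex is a hyperedge iff its digits are distinct. A tuple of old vertices
inherits its status from the input array, where `0` already marks repeated vertices and missing
hyperedges. -/
theorem entry_hashed (I : EEWInstance d) (a c : ℕ)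
    (k : Fin (reducedSize d I.n ^ d)) :
    (I.hashed a c).entry (finFunctionFinEquiv.symm k) =
      RAM.outputEntry d I.n (2 ^ (c + (3 * I.n + 2))) (2 ^ c) a I.array k := by
  set v : Fin d → Fin (reducedSize d I.n) := finFunctionFinEquiv.symm k with hv
  have hval : ∀ i, k.val / reducedSize d I.n ^ i.val % reducedSize d I.n = (v i).val := fun i => by
    rw [hv, finFunctionFinEquiv_symm_apply_val]
  rw [entry_eq]
  simp only [RAM.outputEntry, Finset.sum_range, hval,
    prod_dist_ne_zero_iff (v := fun i => k.val / reducedSize d I.n ^ i % reducedSize d I.n)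
      (f := v) hval]
  have hold : (∑ i, ((v i).val + 1 - I.n) ≠ 0) ↔
      ¬ ∀ u ∈ Finset.univ.image v, u.val < I.n := by
    rw [not_iff_not, Finset.sum_eq_zero_iff]
    simp only [Finset.mem_univ, true_imp_iff, Finset.mem_image, true_and, forall_exists_index,
      forall_apply_eq_imp_iff]
    exact forall_congr' fun i => by omega
  have hcard : (Finset.univ.image v).card = d ↔ Function.Injective v := by
    constructor
    · intro h
      have : Set.InjOn v ((Finset.univ : Finset (Fin d)) : Set (Fin d)) :=
        Finset.card_image_iff.mp (h.trans (by simp))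
      simpa using this
    · intro h
      rw [Finset.card_image_of_injective _ h, Finset.card_univ, Fintype.card_fin]
  by_cases hnew : ∑ i, ((v i).val + 1 - I.n) ≠ 0
  · have hnew' := hold.mp hnew
    rw [if_pos hnew]
    by_cases hvinj : Function.Injective v
    · have hmem : Finset.univ.image v ∈ (I.hashed a c).edges :=
        (mem_edges_reduce I _ _ _).mpr ⟨hcard.mpr hvinj, fun h => absurd h hnew'⟩
      rw [if_pos hmem, if_pos hvinj, wt_reduce I _ _ hmem, if_neg hnew']
      by_cases hcore : core d I.n ⊆ Finset.univ.image v
      · rw [if_pos hcore, if_neg ((core_subset_iff hvinj).mp hcore),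
          Finset.sum_image fun i _ j _ hij => hvinj hij]
      · rw [if_neg hcore, if_pos (not_not.mp (mt (core_subset_iff hvinj).mpr hcore))]
    · rw [if_neg hvinj, if_neg]
      exact fun hmem => hvinj (hcard.mp ((mem_edges_reduce I _ _ _).mp hmem).1)
  · have hnew' := not_not.mp (mt hold.mpr hnew)
    have hlt : ∀ i, (v i).val < I.n := fun i =>
      hnew' _ (Finset.mem_image_of_mem v (Finset.mem_univ i))
    rw [if_neg hnew, getD_array I (fun i => ⟨(v i).val, hlt i⟩), entry_eq]
    set u : Fin d → Fin I.n := fun i => ⟨(v i).val, hlt i⟩ with hu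
    have hpull : pull (d := d) (Finset.univ.image v) = Finset.univ.image u := by
      ext x
      simp [pull, hu, Fin.ext_iff]
    have hcard' : (Finset.univ.image v).card = (Finset.univ.image u).card := by
      have := Finset.card_map (s := pull (d := d) (n := I.n) (Finset.univ.image v))
        (Fin.castAddEmb (d - 1 + 2 * I.n))
      rwa [map_pull _ hnew', hpull] at this
    by_cases hmem : Finset.univ.image u ∈ I.edges
    · have hmem' : Finset.univ.image v ∈ (I.hashed a c).edges :=
        (mem_edges_reduce I _ _ _).mpr
          ⟨hcard'.trans (I.uniform _ hmem), fun _ => hpull ▸ hmem⟩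
      rw [if_pos hmem', wt_reduce I _ _ hmem', if_pos hnew', hpull]
      simp only [if_pos hmem]
      rw [if_pos (Nat.succ_ne_zero _)]
      rfl
    · have hmem' : Finset.univ.image v ∉ (I.hashed a c).edges := fun h =>
        hmem (hpull ▸ ((mem_edges_reduce I _ _ _).mp h).2 hnew')
      rw [if_neg hmem']
      simp only [if_neg hmem]
      rw [if_neg (fun h => h rfl)]

theorem encode_hashed (I : EEWInstance d) (a c : ℕ) :
    (I.hashed a c).encode = reducedSize d I.n ::
      (a * I.target % 2 ^ (c + (3 * I.n + 2)) / 2 ^ c + (2 ^ I.n - 1) * 2 ^ (3 * I.n + 2)) ::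
      (List.range (reducedSize d I.n ^ d)).map
        (RAM.outputEntry d I.n (2 ^ (c + (3 * I.n + 2))) (2 ^ c) a I.array) := by
  unfold encode
  congr 2
  rw [← List.map_coe_finRange_eq_range, List.map_map, List.ofFn_eq_map]
  exact List.map_congr_left fun k _ => entry_hashed I a c k

/-- Each hyperedge occurs in the array through its increasing enumeration. The repetitions only
enlarge the sum, so the program can bound all clique weights by adding up the array. -/
theorem weightOf_le_sum_array (I : EEWInstance d) (S : Finset (Fin I.n)) :
    I.weightOf S ≤ I.array.sum := by
  have h1 : I.array.sum = ∑ v : Fin d → Fin I.n, I.entry v := by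
    rw [array, List.sum_ofFn]
    exact Equiv.sum_comp finFunctionFinEquiv.symm I.entry
  rw [h1, ← Finset.sum_fiberwise Finset.univ (fun v : Fin d → Fin I.n => Finset.univ.image v),
    weightOf_eq]
  refine (Finset.sum_le_sum fun e he => ?_).trans (Finset.sum_le_univ_sum_of_nonneg
    (fun _ => Nat.zero_le _) : ∑ e ∈ I.edges.filter (· ⊆ S), _ ≤ _)
  have he := (Finset.mem_filter.mp he).1
  have hv : Finset.univ.image (e.orderEmbOfFin (I.uniform e he)) = e :=
    Finset.image_orderEmbOfFin_univ e _
  refine le_trans ?_ (Finset.single_le_sum (f := I.entry) (fun _ _ => Nat.zero_le _)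
    (Finset.mem_filter.mpr ⟨Finset.mem_univ _, hv⟩))
  rw [entry_eq, hv, if_pos he]
  omega

end EEWInstance

/-! ### Running time and size of the output -/

namespace EEWInstance

theorem reducedSize_le {d n : ℕ} (hd : 2 ≤ d) (hn : 0 < n) : reducedSize d n ≤ (d + 2) * n := by
  have h1 : d - 1 ≤ (d - 1) * n := Nat.le_mul_of_pos_right _ hn
  have h2 : (d + 2) * n = (d - 1) * n + 3 * n := by
    rw [← add_mul]; congr 1; omega
  simp only [reducedSize]
  omega

theorem reducedSize_pow_le {d n : ℕ} (hd : 2 ≤ d) (hn : 0 < n) :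
    reducedSize d n ^ d ≤ (d + 2) ^ d * n ^ d := by
  rw [← mul_pow]
  exact Nat.pow_le_pow_left (reducedSize_le hd hn) d

end EEWInstance

namespace RAM

open EEWInstance

/-- In `Z`, the term `R` covers the input numbers, the coins and the modulus, `(d + 2) * n * d`
covers the counter up to `N ^ d`, and `4 * n + 3` the slack weights. The eight phases are chained
through their invariants, and their costs share one common bound. -/
theorem exists_bound_reduction {d : ℕ} (hd : 2 ≤ d) :
    ∃ K, ∀ (n t R Z : ℕ) (l : List ℕ) (ω : ℕ → Bool), 0 < n → l.length = n ^ d →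
      R = Nat.size ((t + 1 + l.sum) * 2 ^ (3 * n + 2)) → Z = R + (d + 2) * n * d + 4 * n + 3 →
      ∃ s c, Exec ω (reduction d) (init (n :: t :: l)) s c ∧
        s.output = reducedSize d n ::
          (coinNumber ω R * t % 2 ^ R / (2 ^ R / 2 ^ (3 * n + 2)) +
            (2 ^ n - 1) * 2 ^ (3 * n + 2)) ::
          (List.range (reducedSize d n ^ d)).map
            (outputEntry d n (2 ^ R) (2 ^ R / 2 ^ (3 * n + 2)) (coinNumber ω R) l) ∧
        c ≤ K * ((n ^ d + 2 * n + R + reducedSize d n ^ d + 1) * (Z + 1)) := by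
  obtain ⟨K₁, h₁⟩ := (setup d).exists_bound (by simp [setup, Prog.LoopFree])
  obtain ⟨K₂, h₂⟩ := exists_bound_loop countCond readBody (by simp [readBody, Prog.LoopFree])
  obtain ⟨K₃, h₃⟩ := startTable.exists_bound (by simp [startTable, Prog.LoopFree])
  obtain ⟨K₄, h₄⟩ := exists_bound_loop countCond (tableBody d)
    (by simp [tableBody, Prog.LoopFree])
  obtain ⟨K₅, h₅⟩ := (startCoins d).exists_bound (by simp [startCoins, Prog.LoopFree])
  obtain ⟨K₆, h₆⟩ := exists_bound_loop coinCond coinBody (by simp [coinBody, Prog.LoopFree])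
  obtain ⟨K₇, h₇⟩ := (startOutput d).exists_bound (by simp [startOutput, Prog.LoopFree])
  obtain ⟨K₈, h₈⟩ := exists_bound_loop countCond (outputBody d)
    (by simp [outputBody, Prog.LoopFree])
  refine ⟨K₁ + K₂ + K₃ + K₄ + K₅ + K₆ + K₇ + K₈, fun n t R Z l ω hn hl hR hZ => ?_⟩
  have hAR : (t + 1 + l.sum) * 2 ^ (3 * n + 2) < 2 ^ R := hR ▸ Nat.lt_size_self _
  have hRZ : 2 ^ R < 2 ^ Z := Nat.pow_lt_pow_right (by norm_num) (by omega)
  have hA : t + 1 + l.sum < 2 ^ Z :=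
    (Nat.le_mul_of_pos_right _ (by positivity)).trans_lt (hAR.trans hRZ)
  have hN : reducedSize d n ^ d < 2 ^ Z := by
    calc reducedSize d n ^ d ≤ ((d + 2) * n) ^ d := Nat.pow_le_pow_left (reducedSize_le hd hn) d
      _ ≤ (2 ^ ((d + 2) * n)) ^ d := Nat.pow_le_pow_left Nat.lt_two_pow_self.le d
      _ = 2 ^ ((d + 2) * n * d) := (pow_mul _ _ _).symm
      _ < 2 ^ Z := Nat.pow_lt_pow_right (by norm_num) (by omega)
  have hNN : reducedSize d n ≤ reducedSize d n ^ d := Nat.le_self_pow (by omega) _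
  have hnN : 2 * n ≤ reducedSize d n := by simp only [reducedSize]; omega
  have hlN : l.length ≤ reducedSize d n ^ d := by
    rw [hl]; exact Nat.pow_le_pow_left (by omega) d
  have hin : ∀ x ∈ l, x < 2 ^ Z := fun x hx => by
    have := List.single_le_sum (fun x _ => Nat.zero_le x) x hx
    omega
  have hread : ∀ {i s}, ReadInv d n t Z l i s → s.Bdd Z := fun h =>
    h.toBasic.bdd fun x hx => hin x (List.mem_of_mem_drop (h.input ▸ hx))
  have htable : ∀ {i s}, TableInv d n t Z l i s → s.Bdd Z := fun h =>
    h.toBasic.bdd (by simp [h.input])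
  have hloaded : ∀ {s}, Loaded d n t Z l s → s.Bdd Z := fun h =>
    h.toBasic.bdd (by simp [h.input])
  have hinit : (init (n :: t :: l)).Bdd Z := by
    refine ⟨fun a => by simp [init], fun x hx => Nat.size_le.mpr ?_⟩
    rcases List.mem_cons.mp hx with rfl | hx
    · omega
    · rcases List.mem_cons.mp hx with rfl | hx
      · omega
      · exact hin x hx
  obtain ⟨-, c₁, e₁, b₁⟩ := h₁ ω _ Z hinit
  have i₁ : ReadInv d n t Z l 0 _ := readInv_setup ω (by omega) (by omega) hl (by omega) (by omega)
  obtain ⟨s₂, c₂, e₂, i₂, b₂⟩ := h₂ ω l.length Z (ReadInv d n t Z l) _ i₁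
    (fun i s _ h => hread h)
    (fun i s hi h => ⟨by simp [countCond, h.mem_two, h.mem_nine]; omega,
      h.step ω hi (by omega) hA⟩)
    (fun s h => by simp [countCond, h.mem_two, h.mem_nine])
  obtain ⟨-, c₃, e₃, b₃⟩ := h₃ ω _ Z (hread i₂)
  have i₃ := i₂.startTable ω hn (by omega)
  obtain ⟨s₄, c₄, e₄, i₄, b₄⟩ := h₄ ω (2 * n) Z (TableInv d n t Z l) _ i₃
    (fun i s _ h => htable h)
    (fun i s hi h => ⟨by simp [countCond, h.mem_two, h.mem_nine]; omega,
      h.step ω hi (by omega)⟩)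
    (fun s h => by simp [countCond, h.mem_two, h.mem_nine])
  obtain ⟨-, c₅, e₅, b₅⟩ := h₅ ω _ Z (htable i₄)
  have i₅ := i₄.startCoins ω hn (by omega)
  obtain ⟨s₆, c₆, e₆, i₆, b₆⟩ := h₆ ω R Z (CoinInv d n t Z l ω) _ i₅
    (fun i s _ h => hloaded h.toLoaded)
    (fun i s hi h => ⟨by
      rw [hR, Nat.lt_size] at hi
      simp only [coinCond, RAM.Expr.eval_sub, RAM.Expr.eval_reg, h.mem_five, h.mem_eight]
      omega, h.step ω (by omega)⟩)
    (fun s h => by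
      simp only [coinCond, RAM.Expr.eval_sub, RAM.Expr.eval_reg, h.mem_five, h.mem_eight]
      omega)
  obtain ⟨-, c₇, e₇, b₇⟩ := h₇ ω _ Z (hloaded i₆.toLoaded)
  have i₇ := i₆.startOutput ω (by omega) hN
  obtain ⟨s₈, c₈, e₈, i₈, b₈⟩ := h₈ ω (reducedSize d n ^ d) Z (OutputInv d n t Z l _ _ _ _) _ i₇
    (fun i s _ h => hloaded h.toLoaded)
    (fun i s hi h => ⟨by simp [countCond, h.mem_two, h.mem_nine]; omega,
      h.step ω hl hn hi hN⟩)
    (fun s h => by simp [countCond, h.mem_two, h.mem_nine])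
  refine ⟨s₈, _, .seq e₁ (.seq e₂ (.seq e₃ (.seq e₄ (.seq e₅ (.seq e₆ (.seq e₇ e₈)))))),
    i₈.output, ?_⟩
  rw [hl] at b₂
  set P := (n ^ d + 2 * n + R + reducedSize d n ^ d + 1) * (Z + 1) with hP
  have hle : ∀ {K c m : ℕ}, m ≤ n ^ d + 2 * n + R + reducedSize d n ^ d →
      c ≤ K * ((m + 1) * (Z + 1)) → c ≤ K * P := fun hm hc =>
    hc.trans (Nat.mul_le_mul_left _ (Nat.mul_le_mul_right _ (by omega)))
  have hle' : ∀ {K c : ℕ}, c ≤ K * (Z + 1) → c ≤ K * P := fun hc =>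
    hle (m := 0) (by omega) (by simpa using hc)
  have d₁ := hle' b₁
  have d₂ := hle (by omega) b₂
  have d₃ := hle' b₃
  have d₄ := hle (by omega) b₄
  have d₅ := hle' b₅
  have d₆ := hle (by omega) b₆
  have d₇ := hle' b₇
  have d₈ := hle (by omega) b₈
  simp only [add_mul]
  omega

theorem size_sum_le_bitSize (l : List ℕ) : Nat.size l.sum ≤ bitSize l := by
  induction l with
  | nil => simp
  | cons x l ih =>
    have := size_add_le x l.sum
    simp only [List.sum_cons, bitSize, List.map_cons] at ih ⊢
    omega

theorem length_le_bitSize (l : List ℕ) : l.length ≤ bitSize l := by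
  induction l with
  | nil => simp
  | cons x l ih =>
    simp only [List.length_cons, bitSize, List.map_cons, List.sum_cons] at ih ⊢
    omega

end RAM

namespace EEWInstance

variable {d : ℕ}

theorem vertexWeight_le {n : ℕ} (v : Fin (reducedSize d n)) :
    vertexWeight d n v.val ≤ 2 ^ (4 * n + 2) := by
  have := v.2
  simp only [reducedSize] at this
  unfold vertexWeight slackWeight
  split_ifs
  · exact Nat.zero_le _
  · exact Nat.pow_le_pow_right (by norm_num) (by omega)
  · exact Nat.pow_le_pow_right (by norm_num) (by omega)

theorem hashWeight_lt (n a c w : ℕ) : hashWeight n a c w < 2 ^ (3 * n + 2) := by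
  unfold hashWeight
  refine Nat.div_lt_of_lt_mul ?_
  rw [← pow_add]
  exact Nat.mod_lt _ (by positivity)

theorem wt_hashed_le {I : EEWInstance d} (hn : 0 < I.n) (a c : ℕ)
    {e : Finset (Fin (reducedSize d I.n))} (he : e ∈ (I.hashed a c).edges) :
    (I.hashed a c).wt e ≤ 2 ^ ((d + 6) * I.n) := by
  have hd : d ≤ d * I.n := Nat.le_mul_of_pos_right _ hn
  -- The exponent `(d + 6) * n` dominates `d + (4n + 2)`: slack weights are at most `2 ^ (4n + 2)`,
  -- and a hyperedge sums `d` vertex weights.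
  have hexp : (d + 6) * I.n = d * I.n + 6 * I.n := add_mul _ _ _
  rw [wt_reduce I _ _ he]
  split_ifs
  · exact (hashWeight_lt _ _ _ _).le.trans (Nat.pow_le_pow_right (by norm_num) (by omega))
  · calc ∑ v ∈ e, vertexWeight d I.n v.val ≤ e.card • 2 ^ (4 * I.n + 2) :=
        Finset.sum_le_card_nsmul _ _ _ fun v _ => vertexWeight_le v
      _ ≤ 2 ^ d * 2 ^ (4 * I.n + 2) := by
        rw [smul_eq_mul, ((mem_edges_reduce I _ _ e).mp he).1]
        exact Nat.mul_le_mul_right _ Nat.lt_two_pow_self.le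
      _ = 2 ^ (d + (4 * I.n + 2)) := (pow_add _ _ _).symm
      _ ≤ _ := Nat.pow_le_pow_right (by norm_num) (by omega)
  · exact Nat.zero_le _

theorem target_hashed_le {I : EEWInstance d} (hn : 0 < I.n) (a c : ℕ) :
    (I.hashed a c).target ≤ 2 ^ ((d + 6) * I.n) := by
  have hexp : (d + 6) * I.n = d * I.n + 6 * I.n := add_mul _ _ _
  have h1 := hashWeight_lt I.n a c I.target
  have h2 : (2 ^ I.n - 1) * 2 ^ (3 * I.n + 2) + 2 ^ (3 * I.n + 2) = 2 ^ (4 * I.n + 2) := by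
    have : 2 ^ I.n - 1 + 1 = 2 ^ I.n := Nat.sub_add_cancel (Nat.two_pow_pos _)
    rw [← Nat.succ_mul, Nat.succ_eq_add_one, this, ← pow_add]
    congr 1; omega
  have h3 : 2 ^ (4 * I.n + 2) ≤ 2 ^ ((d + 6) * I.n) :=
    Nat.pow_le_pow_right (by norm_num) (by omega)
  change hashWeight I.n a c I.target + (2 ^ I.n - 1) * 2 ^ (3 * I.n + 2) ≤ _
  omega

/-- The constant slack part of the target is already positive for `n ≥ 1`, whatever the hash of the
old target. -/
theorem target_hashed_pos {I : EEWInstance d} (hn : 0 < I.n) (a c : ℕ) :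
    0 < (I.hashed a c).target := by
  have h1 : 1 < 2 ^ I.n := Nat.one_lt_two_pow (by omega)
  have h2 : 0 < (2 ^ I.n - 1) * 2 ^ (3 * I.n + 2) := Nat.mul_pos (by omega) (by positivity)
  change 0 < hashWeight I.n a c I.target + (2 ^ I.n - 1) * 2 ^ (3 * I.n + 2)
  omega

theorem entry_hashed_le {I : EEWInstance d} (hn : 0 < I.n) (a c : ℕ)
    (v : Fin d → Fin (reducedSize d I.n)) :
    Nat.size ((I.hashed a c).entry v) ≤ (d + 6) * I.n + 2 := by
  rw [entry_eq, Nat.size_le]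
  have hpos := Nat.two_pow_pos ((d + 6) * I.n)
  have h2 : 2 ^ ((d + 6) * I.n + 2) = 4 * 2 ^ ((d + 6) * I.n) := by rw [pow_add]; ring
  split_ifs with h
  · have := wt_hashed_le hn a c h
    omega
  · omega

theorem exists_bitSize_encode_hashed_le (hd : 2 ≤ d) :
    ∃ C, ∀ (I : EEWInstance d) (a c : ℕ), 0 < I.n →
      bitSize (I.hashed a c).encode ≤ C * I.n ^ (d + 1) := by
  refine ⟨(2 * (d + 2) + 1) + (2 * (d + 7) + 1) + (d + 2) ^ d * (2 * (d + 8) + 1),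
    fun I a c hn => ?_⟩
  have hpow : I.n ≤ I.n ^ (d + 1) := Nat.le_self_pow (by omega) _
  have hN : Nat.size (reducedSize d I.n) ≤ (d + 2) * I.n :=
    (Nat.size_le.mpr Nat.lt_two_pow_self).trans (reducedSize_le hd hn)
  have hτ : Nat.size (I.hashed a c).target ≤ (d + 7) * I.n := by
    refine (Nat.size_le_size (target_hashed_le hn a c)).trans ?_
    rw [Nat.size_pow, show (d + 7) * I.n = (d + 6) * I.n + I.n by ring]
    omega
  have harr : ((List.ofFn fun k : Fin (reducedSize d I.n ^ d) =>
      (I.hashed a c).entry (finFunctionFinEquiv.symm k)).map fun x => 2 * Nat.size x + 1).sum ≤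
      ((d + 2) ^ d * I.n ^ d) * ((2 * (d + 8) + 1) * I.n) := by
    refine (List.sum_le_card_nsmul _ ((2 * (d + 8) + 1) * I.n) ?_).trans ?_
    · intro x hx
      obtain ⟨y, hy, rfl⟩ := List.mem_map.mp hx
      obtain ⟨k, rfl⟩ := List.mem_ofFn.mp hy
      have := entry_hashed_le hn a c (finFunctionFinEquiv.symm k)
      have h2 : (2 * (d + 8) + 1) * I.n = 2 * ((d + 6) * I.n) + 5 * I.n := by ring
      omega
    · rw [List.length_map, List.length_ofFn, smul_eq_mul]
      exact Nat.mul_le_mul_right _ (reducedSize_pow_le hd hn)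
  have h1 : bitSize (I.hashed a c).encode = (2 * Nat.size (reducedSize d I.n) + 1) +
      ((2 * Nat.size (I.hashed a c).target + 1) +
      ((List.ofFn fun k : Fin (reducedSize d I.n ^ d) =>
        (I.hashed a c).entry (finFunctionFinEquiv.symm k)).map
          fun x => 2 * Nat.size x + 1).sum) := rfl
  rw [h1]
  calc _ ≤ ((2 * (d + 2) + 1) + (2 * (d + 7) + 1)) * I.n +
        ((d + 2) ^ d * I.n ^ d) * ((2 * (d + 8) + 1) * I.n) := by
        have h2 : ((2 * (d + 2) + 1) + (2 * (d + 7) + 1)) * I.n =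
          2 * ((d + 2) * I.n) + 2 * ((d + 7) * I.n) + 2 * I.n := by ring
        omega
    _ ≤ ((2 * (d + 2) + 1) + (2 * (d + 7) + 1)) * I.n ^ (d + 1) +
        ((d + 2) ^ d * I.n ^ d) * ((2 * (d + 8) + 1) * I.n) := by gcongr
    _ = _ := by rw [pow_succ]; ring

theorem exists_computes_hashed (hd : 2 ≤ d) :
    ∃ T : Polynomial ℕ, ∀ I : EEWInstance d, 0 < I.n → ∃ c,
      (∀ S, ((I.weightOf S : ℤ) - I.target).natAbs ≤ 2 ^ c) ∧
      ∀ ω, ∃ cost, RAM.Computes (RAM.reduction d) I.encode ω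
        (I.hashed (RAM.coinNumber ω (c + (3 * I.n + 2))) c).encode cost ∧
        cost ≤ T.eval (bitSize I.encode) := by
  obtain ⟨K, hK⟩ := RAM.exists_bound_reduction hd
  refine ⟨Polynomial.C (K * ((d + 2) ^ d + 8) * ((d + 2) * d + 16)) * (Polynomial.X + 1) ^ 2,
    fun I hn => ?_⟩
  -- `A` exceeds the target and every clique weight, so `A < 2 ^ c` gives the bound on their
  -- difference. As `R` is the bit length of `A * 2 ^ (3n + 2)`, the choice `c = R - (3n + 2)`
  -- achieves this.
  set A := I.target + 1 + I.array.sum with hA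
  set R := Nat.size (A * 2 ^ (3 * I.n + 2)) with hR
  have hRge : 3 * I.n + 2 ≤ R := by
    refine le_of_lt ?_
    rw [hR, Nat.lt_size]
    exact Nat.le_mul_of_pos_left _ (by omega)
  obtain ⟨c, hc⟩ : ∃ c, R = c + (3 * I.n + 2) := ⟨R - (3 * I.n + 2), by omega⟩
  refine ⟨c, fun S => ?_, fun ω => ?_⟩
  · have h1 : A * 2 ^ (3 * I.n + 2) < 2 ^ c * 2 ^ (3 * I.n + 2) := by
      rw [← pow_add, ← hc]; exact Nat.lt_size_self _
    have h2 := Nat.lt_of_mul_lt_mul_right h1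
    have h3 := I.weightOf_le_sum_array S
    omega
  · have hlen : I.array.length = I.n ^ d := List.length_ofFn
    obtain ⟨s, cost, hex, hout, hcost⟩ := hK I.n I.target R _ I.array ω hn hlen hR rfl
    refine ⟨cost, ⟨s, hex, ?_⟩, hcost.trans ?_⟩
    · have hD : 2 ^ R / 2 ^ (3 * I.n + 2) = 2 ^ c := by
        rw [hc, pow_add, Nat.mul_div_cancel _ (by positivity)]
      rw [hout, encode_hashed, hD, hc]
    · set B := bitSize I.encode with hB
      have hBeq : B = (2 * Nat.size I.n + 1) + ((2 * Nat.size I.target + 1) + bitSize I.array) := rfl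
      -- Every array entry occupies at least one bit, so quantities polynomial in `n` are polynomial
      -- in the input size.
      have h1 : I.n ^ d ≤ B := by
        have := RAM.length_le_bitSize I.array
        omega
      have h2 : I.n ≤ I.n ^ d := Nat.le_self_pow (by omega) _
      have h3 : R ≤ 4 * B + 4 := by
        have h4 := RAM.size_mul_le A (2 ^ (3 * I.n + 2))
        have h5 := RAM.size_add_le (I.target + 1) I.array.sum
        have h6 := RAM.size_add_le I.target 1
        have h7 := RAM.size_sum_le_bitSize I.array
        rw [← hA] at h5
        rw [Nat.size_pow] at h4
        rw [Nat.size_one] at h6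
        omega
      have h8 := reducedSize_pow_le hd hn
      have h9 : (d + 2) ^ d * I.n ^ d ≤ (d + 2) ^ d * B := Nat.mul_le_mul_left _ h1
      have h10 : (d + 2) * I.n * d ≤ (d + 2) * d * B := by
        rw [mul_right_comm]; exact Nat.mul_le_mul_left _ (h2.trans h1)
      have h11 : I.n ^ d + 2 * I.n + R + reducedSize d I.n ^ d + 1 ≤
          ((d + 2) ^ d + 8) * (B + 1) := by
        have : ((d + 2) ^ d + 8) * (B + 1) = (d + 2) ^ d * B + (d + 2) ^ d + 8 * B + 8 := by ring
        omega
      have h12 : R + (d + 2) * I.n * d + 4 * I.n + 3 + 1 ≤ ((d + 2) * d + 16) * (B + 1) := by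
        have : ((d + 2) * d + 16) * (B + 1) = (d + 2) * d * B + (d + 2) * d + 16 * B + 16 := by ring
        omega
      calc _ ≤ K * ((((d + 2) ^ d + 8) * (B + 1)) * (((d + 2) * d + 16) * (B + 1))) :=
          Nat.mul_le_mul_left _ (Nat.mul_le_mul h11 h12)
        _ = _ := by
          simp only [Polynomial.eval_mul, Polynomial.eval_C, Polynomial.eval_pow,
            Polynomial.eval_add, Polynomial.eval_X, Polynomial.eval_one]
          ring

end EEWInstance

theorem mainTheorem2 (d : ℕ) (hd : 2 ≤ d) :
    ∃ (p : RAM.Prog) (T : Polynomial ℕ) (C : ℕ), ∀ I : EEWInstance d, 1 ≤ I.n →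
      (∀ ω : ℕ → Bool, ∃ (J : EEWInstance d) (c : ℕ),
        RAM.Computes p I.encode ω J.encode c ∧
        c ≤ T.eval (bitSize I.encode) ∧
        bitSize J.encode ≤ C * I.n ^ (d + 1) ∧
        (∀ e, J.weight e ≤ 2 ^ (C * I.n)) ∧
        0 < J.target ∧ J.target ≤ 2 ^ (C * I.n) ∧
        (I.IsYes → J.IsYes)) ∧
      (¬ I.IsYes →
        1 - (2⁻¹ : ENNReal) ^ I.n ≤
          RAM.fairCoins {ω | ∃ (J : EEWInstance d) (c : ℕ),
            RAM.Computes p I.encode ω J.encode c ∧ ¬ J.IsYes}) := by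
  obtain ⟨T, hT⟩ := EEWInstance.exists_computes_hashed hd
  obtain ⟨C, hC⟩ := EEWInstance.exists_bitSize_encode_hashed_le hd
  refine ⟨RAM.reduction d, T, C + (d + 6), fun I hn => ?_⟩
  obtain ⟨c, hc, hcomp⟩ := hT I hn
  have hpow : 2 ^ ((d + 6) * I.n) ≤ 2 ^ ((C + (d + 6)) * I.n) :=
    Nat.pow_le_pow_right (by norm_num) (Nat.mul_le_mul_right _ (by omega))
  constructor
  · intro ω
    obtain ⟨cost, h1, h2⟩ := hcomp ω
    set a := RAM.coinNumber ω (c + (3 * I.n + 2))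
    refine ⟨I.hashed a c, cost, h1, h2,
      (hC I a c hn).trans (Nat.mul_le_mul_right _ (by omega)), fun e => ?_,
      EEWInstance.target_hashed_pos hn a c,
      (EEWInstance.target_hashed_le hn a c).trans hpow,
      fun h => EEWInstance.isYes_hashed hd h a c⟩
    have h3 := EEWInstance.wt_hashed_le hn a c e.2
    rw [EEWInstance.wt, dif_pos e.2] at h3
    exact h3.trans hpow
  · intro hI
    have h1 := EEWInstance.fairCoins_isYes_hashed_le hd hI hc
    set good := {ω | ∃ (J : EEWInstance d) (c : ℕ),
      RAM.Computes (RAM.reduction d) I.encode ω J.encode c ∧ ¬ J.IsYes} with hgood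
    have h2 : goodᶜ ⊆
        {ω | (I.hashed (RAM.coinNumber ω (c + (3 * I.n + 2))) c).IsYes} := by
      intro ω hω
      by_contra hno
      obtain ⟨cost, h3, -⟩ := hcomp ω
      exact hω ⟨_, cost, h3, hno⟩
    -- Subadditivity alone suffices here, so measurability of the event is not required.
    have h3 : (1 : ENNReal) ≤ RAM.fairCoins good + RAM.fairCoins goodᶜ := by
      rw [← measure_univ (μ := RAM.fairCoins), ← Set.union_compl_self good]
      exact measure_union_le _ _
    rw [tsub_le_iff_right]
    exact h3.trans (add_le_add_right ((measure_mono h2).trans h1) _)
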